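/- **Setting.** A (general) logic program $P$ is a finite list of clauses $A\leftarrow L_1,\dots,L_n$ with $A$ an atom and each $L_i$ an atom or a negated atom. A query $Q=p(a_1,\dots,a_n)$ is one atom in which each argument is a term or an *input mode* (a place holder for an arbitrary ground term); $Q$ is concrete if it has no input mode and moded otherwise. Goals are evaluated by SLDNF-resolution with the depth-first, left-most control strategy, clauses being tried in textual order and renamed apart. The mgus are idempotent and relevant, a variable of the goal is never replaced by a variable of the clause, and an input variable (see below) is never replaced by an ordinary variable. The *generalized SLDNF-tree* with root $\leftarrow A$ consists of the SLDNF-tree for $\leftarrow A$ together with, for each node at which a ground negative subgoal $\neg B$ is selected, an arc to the root $\leftarrow B$ of a subsidiary tree, where $B$ inherits the ancestors of $\neg B$. The node itself has a child (with $\neg B$ removed) iff the subsidiary SLDNF-tree fails finitely. A subsidiary tree stops at its first success leaf. When a positive subgoal $L$ is resolved with a clause, $L$ and the ancestors of $L$ are the ancestors of the new subgoals from the clause body; the other subgoals keep their ancestors. A *derivation* is a path starting at the root; it may pass through negation arcs. $P$ is *non-terminating for* $Q$ if some generalized SLDNF-tree obtained from $Q$ by replacing the input modes by ground terms of the Herbrand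 universe of $P$ has an infinite derivation. (The Herbrand universe is built from the function symbols and constants of $P$; a constant is added if $P$ has none.) The *moded generalized SLDNF-tree* $MT_Q$ is the generalized SLDNF-tree whose root is $Q$ with its input modes replaced by distinct new variables, called input variables. When an input variable is replaced by a term, all variables of that term become input variables. $Q$ is *non-floundering* if no negative subgoal containing a variable is selected at any node of $MT_Q$. **Loop goals.** The symbol string of an atom is the sequence of its predicate symbol, function symbols, constants and variables, read from left to right, with every variable replaced by one symbol $\mathcal X$. A goal $G_j$ at a node of a derivation is a *loop goal* of an earlier goal $G_i$ if the selected subgoals $A_i$, $A_j$ are positive with the same predicate symbol, $A_i$ is an ancestor of $A_j$, and the symbol string of $A_i$ is a (not necessarily contiguous) subsequence of that of $A_j$. For $r\ge2$, an *$r$-loop prefix* with looping clause $C$ is a prefix of a derivation $$N_0:G_0\Rightarrow\cdots N_{g_1}:G_{g_1}\Rightarrow_C\cdots N_{g_2}:G_{g_2}\Rightarrow_C\cdots N_{g_r}:G_{g_r}\Rightarrow_C$$ in which the same clause $C$ is applied at $N_{g_1},\dots,N_{g_r}$ and $G_{g_{j+1}}$ is a loop goal of $G_{g_j}$ for $1\le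 j<r$. It has the *term-size decrease property* if for every $0<i<r$ some resolution step from $N_{g_i}$ on and before $N_{g_{i+1}}$ replaces an input variable $X$ by a term $f(\dots Y\dots)$ such that the variable $Y$ appears in the selected subgoal of $G_{g_{i+1}}$. **Algorithm (input $P$, $Q$, $r\ge 2$).** Set $L=0$ and construct $MT_Q$ depth-first. Whenever an $r$-loop prefix is produced: if it does not have the term-size decrease property, stop with the answer "predicted-non-terminating"; otherwise set $L=1$ and skip its looping clause at $N_{g_r}$. If the construction is completed, answer "terminating" if $L=0$ and "predicted-terminating" if $L=1$. **Theorem.** Let $P$ be a logic program and let $Q$ be a (concrete or moded) non-floundering query such that $P$ is non-terminating for $Q$. Then there is a number $R\ge 2$ such that, for every $r\ge R$, the algorithm with repetition number $r$ halts with the answer "predicted-non-terminating" (and with no other answer). The number $R$ can be chosen independently of how mgus are chosen in the construction of $MT_Q$. -/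

import Mathlib

namespace TermPred

universe u v

/-! ## Terms, atoms, logic programs -/

/-- Terms over the language `L`; the variables are the natural numbers. -/
abbrev Tm (L : FirstOrder.Language.{u, v}) := L.Term ℕ

/-- A substitution; the variable `x` is bound to `θ x` (unbound when `θ x` is `x` itself). -/
abbrev Subst (L : FirstOrder.Language.{u, v}) := ℕ → Tm L

/-- The elements of symbol strings: predicate symbols, function symbols (constants are function
symbols of arity `0`), and the one symbol `X` that stands for every variable. -/
inductive Sym (L : FirstOrder.Language.{u, v})
  | pred (p : Σ n, L.Relations n)
  | fn (f : Σ n, L.Functions n)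
  | X

/-- The symbol string of a term. -/
def symTerm {L : FirstOrder.Language.{u, v}} : Tm L → List (Sym L)
  | .var _ => [Sym.X]
  | @FirstOrder.Language.Term.func _ _ n f ts =>
    Sym.fn ⟨n, f⟩ :: (List.ofFn fun i => symTerm (ts i)).flatten

/-- An atom `p(T₁, …, Tₙ)`. -/
structure Atom (L : FirstOrder.Language.{u, v}) where
  arity : ℕ
  pred : L.Relations arity
  args : Fin arity → Tm L

namespace Atom

def vars {L : FirstOrder.Language.{u, v}} (A : Atom L) : Finset ℕ :=
  Finset.univ.biUnion fun i => (A.args i).varFinset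

def subst {L : FirstOrder.Language.{u, v}} (θ : Subst L) (A : Atom L) : Atom L :=
  ⟨A.arity, A.pred, fun i => (A.args i).subst θ⟩

def predSym {L : FirstOrder.Language.{u, v}} (A : Atom L) : Σ n, L.Relations n := ⟨A.arity, A.pred⟩

/-- The symbol string of an atom. -/
def sym {L : FirstOrder.Language.{u, v}} (A : Atom L) : List (Sym L) :=
  Sym.pred A.predSym :: (List.ofFn fun i => symTerm (A.args i)).flatten

/-- `A` loops into `B`: they have the same predicate symbol, and the symbol string of `A` is a
projection of that of `B`, i.e. obtained from it by removing zero or more elements. -/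
def LoopsInto {L : FirstOrder.Language.{u, v}} (A B : Atom L) : Prop :=
  A.predSym = B.predSym ∧ A.sym.Sublist B.sym

end Atom

inductive Literal (L : FirstOrder.Language.{u, v})
  | pos (A : Atom L)
  | neg (A : Atom L)

namespace Literal

def atom {L : FirstOrder.Language.{u, v}} : Literal L → Atom L
  | pos A => A
  | neg A => A

def subst {L : FirstOrder.Language.{u, v}} (θ : Subst L) : Literal L → Literal L
  | pos A => pos (A.subst θ)
  | neg A => neg (A.subst θ)

end Literal

/-- A clause `head ← body`. -/
structure Clause (L : FirstOrder.Language.{u, v}) where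
  head : Atom L
  body : List (Literal L)

namespace Clause

def atoms {L : FirstOrder.Language.{u, v}} (C : Clause L) : List (Atom L) :=
  C.head :: C.body.map Literal.atom

def vars {L : FirstOrder.Language.{u, v}} (C : Clause L) : Finset ℕ :=
  C.atoms.foldr (fun A s => A.vars ∪ s) ∅

def subst {L : FirstOrder.Language.{u, v}} (θ : Subst L) (C : Clause L) : Clause L :=
  ⟨C.head.subst θ, C.body.map (Literal.subst θ)⟩

/-- The variant of `C` whose variables are renamed apart from all variables in `used`. -/
def fresh {L : FirstOrder.Language.{u, v}} (C : Clause L) (used : Finset ℕ) : Clause L :=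
  C.subst fun x => .var (x + (used.sup id + 1))

end Clause

/-- A (general) logic program: finitely many clauses, in textual order. -/
abbrev Program (L : FirstOrder.Language.{u, v}) := List (Clause L)

/-- The function symbol `f` occurs in the program `P`. -/
def Program.HasFn {L : FirstOrder.Language.{u, v}}
    (P : Program L) {n : ℕ} (f : L.Functions n) : Prop :=
  ∃ C ∈ P, ∃ A ∈ C.atoms, Sym.fn ⟨n, f⟩ ∈ A.sym

/-- The Herbrand universe of `P`: the ground terms built from the function symbols and constants
of `P`; when `P` has no constant, the constant `c` is added. -/
inductive HU {L : FirstOrder.Language.{u, v}} (P : Program L) (c : L.Constants) : Tm L → Prop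
  | func {n : ℕ} (f : L.Functions n) (ts : Fin n → Tm L) (hf : Program.HasFn P f)
      (hts : ∀ i, HU P c (ts i)) : HU P c (.func f ts)
  | extra (ts : Fin 0 → Tm L) (hP : ∀ d : L.Constants, ¬ Program.HasFn P (n := 0) d) :
      HU P c (.func (l := 0) c ts)

/-! ## Most general unifiers -/

def Unifies {L : FirstOrder.Language.{u, v}}
    (θ : Subst L) (A B : Atom L) : Prop := A.subst θ = B.subst θ

/-- `θ` is an (idempotent, relevant) mgu of the selected atom `A` of a goal and the head `B` of a
renamed clause, where `inp` is the set of input variables. A variable of the goal is never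
replaced by a variable of the clause, and an input variable is never replaced by an ordinary
variable. -/
structure IsMgu {L : FirstOrder.Language.{u, v}}
    (inp : Finset ℕ) (A B : Atom L) (θ : Subst L) : Prop where
  unifies : Unifies θ A B
  general : ∀ τ : Subst L, Unifies τ A B → ∃ δ : Subst L, ∀ x, τ x = (θ x).subst δ
  idem : ∀ x, (θ x).subst θ = θ x
  relevant : ∀ x, x ∉ A.vars ∪ B.vars → θ x = .var x
  range : ∀ x ∈ A.vars ∪ B.vars, (θ x).varFinset ⊆ A.vars ∪ B.vars
  goal_var : ∀ x ∈ A.vars, ∀ y, θ x = .var y → y ∈ A.vars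
  inp_var : ∀ x ∈ inp, ∀ y, θ x = .var y → y ∈ inp

/-- A way of choosing mgus: mgus are unique only up to renaming, and a rule picks one of them for
every unifiable pair of an atom and the head of a clause renamed apart. -/
structure MguRule (L : FirstOrder.Language.{u, v}) where
  mgu : Finset ℕ → Atom L → Atom L → Subst L
  spec : ∀ (inp : Finset ℕ) (A B : Atom L), Disjoint A.vars B.vars → Disjoint inp B.vars →
    (∃ τ, Unifies τ A B) → IsMgu inp A B (mgu inp A B)

/-! ## Generalized SLDNF-trees -/

/-- An occurrence of a literal in a goal. A node of a path is referred to by its depth, and `anc`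
is the set of the depths of the nodes at which the ancestors of this subgoal were selected. -/
structure Subgoal (L : FirstOrder.Language.{u, v}) where
  lit : Literal L
  anc : Finset ℕ

def Subgoal.subst {L : FirstOrder.Language.{u, v}} (θ : Subst L) (g : Subgoal L) : Subgoal L :=
  ⟨g.lit.subst θ, g.anc⟩

/-- A node of a generalized SLDNF-tree. -/
structure Node (L : FirstOrder.Language.{u, v}) where
  /-- the subgoals; the selected one is the left-most -/
  goal : List (Subgoal L)
  /-- the variables used so far on the path from the root -/
  used : Finset ℕ
  /-- the input variables -/
  inp : Finset ℕ
  /-- whether the node lies in a subsidiary SLDNF-tree -/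
  sub : Bool
  /-- the number of edges from the root -/
  depth : ℕ

/-- `ClauseStep U P N k θ N'`: the selected subgoal of `N` is positive and unifies with the head
of the (renamed) `k`-th clause of `P` with mgu `θ`, and `N'` carries the resolvent. The selected
subgoal and its ancestors become the ancestors of the subgoals from the body. When an input
variable is replaced by a term, all variables of the term become input variables. -/
inductive ClauseStep {L : FirstOrder.Language.{u, v}}
    (U : MguRule L) (P : Program L) (N : Node L) (k : ℕ) :
    Subst L → Node L → Prop
  | intro (A : Atom L) (anc : Finset ℕ) (rest : List (Subgoal L)) (C : Clause L) (θ : Subst L)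
      (hgoal : N.goal = ⟨.pos A, anc⟩ :: rest)
      (hC : P[k]? = some C)
      (huni : ∃ τ, Unifies τ A (C.fresh N.used).head)
      (hθ : θ = U.mgu N.inp A (C.fresh N.used).head) :
      ClauseStep U P N k θ
        { goal := ((C.fresh N.used).body.map fun l => ⟨l.subst θ, insert N.depth anc⟩) ++
            rest.map (Subgoal.subst θ)
          used := N.used ∪ (C.fresh N.used).vars
          inp := N.inp ∪ N.inp.biUnion fun x => (θ x).varFinset
          sub := N.sub
          depth := N.depth + 1 }

/-- `NegStep N M N'`: the selected subgoal of `N` is a ground negative literal `¬A`, `M` is the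
root `← A` of its subsidiary SLDNF-tree (where `A` inherits the ancestors of `¬A`), and `N'` is
the child of `N` in which `¬A` has been removed as proved. -/
inductive NegStep {L : FirstOrder.Language.{u, v}} (N : Node L) : Node L → Node L → Prop
  | intro (A : Atom L) (anc : Finset ℕ) (rest : List (Subgoal L))
      (hgoal : N.goal = ⟨.neg A, anc⟩ :: rest) (hground : A.vars = ∅) :
      NegStep N
        { goal := [⟨.pos A, anc⟩], used := N.used, inp := N.inp, sub := true,
          depth := N.depth + 1 }
        { goal := rest, used := N.used, inp := N.inp, sub := N.sub, depth := N.depth + 1 }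

mutual

/-- The SLDNF-tree rooted at the node has a success leaf. -/
inductive Succeeds {L : FirstOrder.Language.{u, v}} (U : MguRule L) (P : Program L) : Node L → Prop
  | empty (N : Node L) (h : N.goal = []) : Succeeds U P N
  | clause (N : Node L) (k : ℕ) (θ : Subst L) (N' : Node L) (h : ClauseStep U P N k θ N')
      (h' : Succeeds U P N') : Succeeds U P N
  | naf (N M N' : Node L) (h : NegStep N M N') (hM : FinFails U P M) (h' : Succeeds U P N') :
      Succeeds U P N

/-- The SLDNF-tree rooted at the node is finite and all its leaves are failure leaves. -/
inductive FinFails {L : FirstOrder.Language.{u, v}} (U : MguRule L) (P : Program L) : Node L → Prop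
  | clause (N : Node L) (A : Atom L) (anc : Finset ℕ) (rest : List (Subgoal L))
      (hgoal : N.goal = ⟨.pos A, anc⟩ :: rest)
      (h : ∀ k θ N', ClauseStep U P N k θ N' → FinFails U P N') : FinFails U P N
  | neg (N M N' : Node L) (h : NegStep N M N') (hM : Succeeds U P M) : FinFails U P N
  | naf (N M N' : Node L) (h : NegStep N M N') (hM : FinFails U P M) (h' : FinFails U P N') :
      FinFails U P N

end

/-- The edges of a generalized SLDNF-tree. In a subsidiary tree, nothing to the right of a success
leaf is generated, because it stops at its first success leaf in depth-first order. The edge `arc`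
is the negation arc from `¬A` to the subsidiary tree for `A`. -/
inductive Child {L : FirstOrder.Language.{u, v}}
    (U : MguRule L) (P : Program L) (N : Node L) : Node L → Prop
  | clause (k : ℕ) (θ : Subst L) (N' : Node L) (h : ClauseStep U P N k θ N')
      (hprune : N.sub = true → ∀ j < k, ∀ θ' N'', ClauseStep U P N j θ' N'' →
        ¬ Succeeds U P N'') : Child U P N N'
  | arc (M N' : Node L) (h : NegStep N M N') : Child U P N M
  | naf (M N' : Node L) (h : NegStep N M N') (hM : FinFails U P M) : Child U P N N'

/-- `N` is a node of the generalized SLDNF-tree with the given root. -/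
def InTree {L : FirstOrder.Language.{u, v}}
    (U : MguRule L) (P : Program L) (root N : Node L) : Prop :=
  Relation.ReflTransGen (Child U P) root N

/-- The generalized SLDNF-tree with the given root has an infinite derivation. -/
def HasInfiniteDerivation {L : FirstOrder.Language.{u, v}}
    (U : MguRule L) (P : Program L) (root : Node L) :
    Prop :=
  ∃ N : ℕ → Node L, N 0 = root ∧ ∀ i, Child U P (N i) (N (i + 1))

/-- The root for the top goal `← A`, where `inp` is the set of input variables of `A`. -/
def rootNode {L : FirstOrder.Language.{u, v}} (A : Atom L) (inp : Finset ℕ) : Node L :=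
  { goal := [⟨.pos A, ∅⟩], used := A.vars, inp := inp, sub := false, depth := 0 }

/-! ## Queries -/

/-- A query `p(a₁, …, aₙ)`: every argument is a term (`some t`) or an input mode (`none`). The
query is concrete when it has no input mode, and moded otherwise. -/
structure Query (L : FirstOrder.Language.{u, v}) where
  arity : ℕ
  pred : L.Relations arity
  args : Fin arity → Option (Tm L)

namespace Query

/-- The atom in which the input mode at position `i` is replaced by the term `t i`. -/
def inst {L : FirstOrder.Language.{u, v}} (Q : Query L) (t : Fin Q.arity → Tm L) : Atom L :=
  ⟨Q.arity, Q.pred, fun i => (Q.args i).getD (t i)⟩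

/-- The variables in the arguments that are terms. -/
def vars {L : FirstOrder.Language.{u, v}} (Q : Query L) : Finset ℕ :=
  Finset.univ.biUnion fun i => ((Q.args i).map FirstOrder.Language.Term.varFinset).getD ∅

/-- The input variable for the input mode at position `i`: they are distinct, and do not occur in
the other arguments. -/
def inpVar {L : FirstOrder.Language.{u, v}}
    (Q : Query L) (i : Fin Q.arity) : ℕ := Q.vars.sup id + 1 + i

/-- The root of the moded generalized SLDNF-tree for `Q`: every input mode is replaced by its
input variable. -/
def modedRoot {L : FirstOrder.Language.{u, v}} (Q : Query L) : Node L :=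
  rootNode (Q.inst fun i => .var (Q.inpVar i))
    ((Finset.univ.filter fun i => (Q.args i).isNone = true).image Q.inpVar)

end Query

/-- `P` is non-terminating for `Q`: the moded-query forest, i.e. the set of all generalized
SLDNF-trees for `Q` with its input modes replaced by ground terms of the Herbrand universe, has an
infinite derivation. -/
def NonTerminating {L : FirstOrder.Language.{u, v}}
    (P : Program L) (c : L.Constants) (Q : Query L) : Prop :=
  ∃ (U : MguRule L) (t : Fin Q.arity → Tm L), (∀ i, Q.args i = none → HU P c (t i)) ∧
    HasInfiniteDerivation U P (rootNode (Q.inst t) ∅)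

/-- No negative subgoal that contains ordinary or input variables is selected at any node of the
moded generalized SLDNF-tree of `P` for `Q`. -/
def NonFloundering {L : FirstOrder.Language.{u, v}}
    (U : MguRule L) (P : Program L) (Q : Query L) : Prop :=
  ∀ N : Node L, InTree U P Q.modedRoot N → ∀ (A : Atom L) (anc : Finset ℕ)
    (rest : List (Subgoal L)), N.goal = ⟨.neg A, anc⟩ :: rest → A.vars = ∅

/-! ## The prediction algorithm -/

/-- The label of an edge: resolution with the `k`-th clause and mgu `θ`, a negation arc, or the
removal of a proved negative subgoal. -/
inductive Edge (L : FirstOrder.Language.{u, v})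
  | clause (k : ℕ) (θ : Subst L)
  | arc
  | naf

/-- A prefix of a derivation: the nodes from the root on, each with the edge that leaves it. -/
abbrev Path (L : FirstOrder.Language.{u, v}) := List (Node L × Edge L)

namespace Path

/-- The goal at the `j`-th node is a loop goal of the goal at the `i`-th node: the selected
subgoals are positive, the first is an ancestor of the second, and loops into it. -/
def LoopGoal {L : FirstOrder.Language.{u, v}} (D : Path L) (i j : ℕ) : Prop :=
  ∃ (N N' : Node L) (e e' : Edge L) (A A' : Atom L) (anc anc' : Finset ℕ)
    (rest rest' : List (Subgoal L)),
    D[i]? = some (N, e) ∧ N.goal = ⟨.pos A, anc⟩ :: rest ∧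
    D[j]? = some (N', e') ∧ N'.goal = ⟨.pos A', anc'⟩ :: rest' ∧
    i ∈ anc' ∧ A.LoopsInto A'

/-- The prefix `D` has the form `N₀ ⇒ … N_{g 1} ⇒ₖ … N_{g 2} ⇒ₖ … N_{g r} ⇒ₖ` of LP-check, with
looping clause `k`. -/
structure IsLoop {L : FirstOrder.Language.{u, v}}
    (r : ℕ) (D : Path L) (g : ℕ → ℕ) (k : ℕ) : Prop where
  last : g r + 1 = D.length
  loop : ∀ j, 1 ≤ j → j < r → D.LoopGoal (g j) (g (j + 1))
  clause : ∀ j, 1 ≤ j → j ≤ r → ∃ N θ, D[g j]? = some (N, .clause k θ)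

/-- The term-size decrease property: for `0 < i < r` there is, between `N_{g i}` and
`N_{g (i+1)}`, a substitution `x / f(… y …)` where `x` is an input variable and `y` appears in the
selected subgoal at `N_{g (i+1)}`. -/
def TermSizeDecrease {L : FirstOrder.Language.{u, v}} (r : ℕ) (D : Path L) (g : ℕ → ℕ) : Prop :=
  ∀ i, 0 < i → i < r → ∃ s, g i ≤ s ∧ s < g (i + 1) ∧
    ∃ (N : Node L) (k : ℕ) (θ : Subst L), D[s]? = some (N, .clause k θ) ∧
    ∃ x ∈ N.inp, ∃ (n : ℕ) (f : L.Functions n) (ts : Fin n → Tm L), θ x = .func f ts ∧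
    ∃ y ∈ (θ x).varFinset, ∃ (N' : Node L) (e : Edge L) (l : Literal L) (anc : Finset ℕ)
      (rest : List (Subgoal L)),
      D[g (i + 1)]? = some (N', e) ∧ N'.goal = ⟨l, anc⟩ :: rest ∧ y ∈ l.atom.vars

end Path

/-- The outcome of the construction of the part of the tree below a node: it is stopped by a
prefix that satisfies the conditions of LP-check without the term-size decrease property, or it is
completed, with the information whether the constructed part of the SLDNF-tree has a success leaf
and with the current value of the variable `L` of the algorithm (`true` for `1`). -/
inductive Outcome
  | stopped
  | done (success : Bool) (flag : Bool)

/-- The outcome at a node whose earlier children have a success leaf iff `s` is `true`, and whose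
later children have the outcome `o`. -/
def Outcome.orSuccess (s : Bool) : Outcome → Outcome
  | stopped => stopped
  | done s' b => done (s || s') b

mutual

/-- `Build U P r D N b o`: the depth-first, left-most construction of the tree below the node `N`,
reached by the path `D` while the algorithm's variable `L` has the value `b`, comes to an end after
finitely many steps with outcome `o`. -/
inductive Build {L : FirstOrder.Language.{u, v}} (U : MguRule L) (P : Program L) (r : ℕ) :
    Path L → Node L → Bool → Outcome → Prop
  | empty (D : Path L) (N : Node L) (b : Bool) (h : N.goal = []) :
      Build U P r D N b (.done true b)
  | pos (D : Path L) (N : Node L) (b : Bool) (o : Outcome) (A : Atom L) (anc : Finset ℕ)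
      (rest : List (Subgoal L)) (hgoal : N.goal = ⟨.pos A, anc⟩ :: rest)
      (h : BuildFrom U P r D N 0 b o) : Build U P r D N b o
  | neg_stopped (D : Path L) (N M N' : Node L) (b : Bool) (h : NegStep N M N')
      (hM : Build U P r (D ++ [(N, .arc)]) M b .stopped) : Build U P r D N b .stopped
  | neg_fail (D : Path L) (N M N' : Node L) (b b' : Bool) (h : NegStep N M N')
      (hM : Build U P r (D ++ [(N, .arc)]) M b (.done true b')) :
      Build U P r D N b (.done false b')
  | neg_succ (D : Path L) (N M N' : Node L) (b b' : Bool) (o : Outcome) (h : NegStep N M N')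
      (hM : Build U P r (D ++ [(N, .arc)]) M b (.done false b'))
      (h' : Build U P r (D ++ [(N, .naf)]) N' b' o) : Build U P r D N b o

/-- The same when only the clauses with index at least `k` are still to be applied at `N`. -/
inductive BuildFrom {L : FirstOrder.Language.{u, v}} (U : MguRule L) (P : Program L) (r : ℕ) :
    Path L → Node L → ℕ → Bool → Outcome → Prop
  /-- no clause is left -/
  | last (D : Path L) (N : Node L) (k : ℕ) (b : Bool) (hk : P.length ≤ k) :
      BuildFrom U P r D N k b (.done false b)
  /-- the `k`-th clause is not applicable -/
  | none (D : Path L) (N : Node L) (k : ℕ) (b : Bool) (o : Outcome) (hk : k < P.length)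
      (h : ∀ θ N', ¬ ClauseStep U P N k θ N') (h' : BuildFrom U P r D N (k + 1) b o) :
      BuildFrom U P r D N k b o
  /-- a prefix that satisfies LP-check but not the term-size decrease property is produced -/
  | cut (D : Path L) (N : Node L) (k : ℕ) (b : Bool) (θ : Subst L) (N' : Node L)
      (h : ClauseStep U P N k θ N') (g : ℕ → ℕ)
      (hg : Path.IsLoop r (D ++ [(N, .clause k θ)]) g k)
      (hdec : ¬ Path.TermSizeDecrease r (D ++ [(N, .clause k θ)]) g) :
      BuildFrom U P r D N k b .stopped
  /-- a prefix that satisfies LP-check and the term-size decrease property is produced: the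
  variable `L` is set to `1`, and the looping clause is skipped -/
  | skip (D : Path L) (N : Node L) (k : ℕ) (b : Bool) (o : Outcome) (θ : Subst L) (N' : Node L)
      (h : ClauseStep U P N k θ N')
      (hg : ∃ g, Path.IsLoop r (D ++ [(N, .clause k θ)]) g k)
      (hdec : ∀ g, Path.IsLoop r (D ++ [(N, .clause k θ)]) g k →
        Path.TermSizeDecrease r (D ++ [(N, .clause k θ)]) g)
      (h' : BuildFrom U P r D N (k + 1) true o) : BuildFrom U P r D N k b o
  /-- the construction stops below the child obtained by the `k`-th clause -/
  | child_stopped (D : Path L) (N : Node L) (k : ℕ) (b : Bool) (θ : Subst L) (N' : Node L)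
      (h : ClauseStep U P N k θ N')
      (hg : ¬ ∃ g, Path.IsLoop r (D ++ [(N, .clause k θ)]) g k)
      (hN' : Build U P r (D ++ [(N, .clause k θ)]) N' b .stopped) :
      BuildFrom U P r D N k b .stopped
  /-- a subsidiary tree stops at its first success leaf -/
  | first_success (D : Path L) (N : Node L) (k : ℕ) (b b' : Bool) (θ : Subst L) (N' : Node L)
      (h : ClauseStep U P N k θ N')
      (hg : ¬ ∃ g, Path.IsLoop r (D ++ [(N, .clause k θ)]) g k)
      (hN' : Build U P r (D ++ [(N, .clause k θ)]) N' b (.done true b'))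
      (hsub : N.sub = true) : BuildFrom U P r D N k b (.done true b')
  /-- the child has been completed, and the construction goes on with clause `k + 1` -/
  | next (D : Path L) (N : Node L) (k : ℕ) (b s b' : Bool) (o : Outcome) (θ : Subst L)
      (N' : Node L) (h : ClauseStep U P N k θ N')
      (hg : ¬ ∃ g, Path.IsLoop r (D ++ [(N, .clause k θ)]) g k)
      (hN' : Build U P r (D ++ [(N, .clause k θ)]) N' b (.done s b'))
      (hsub : ¬ (N.sub = true ∧ s = true))
      (h' : BuildFrom U P r D N (k + 1) b' o) :
      BuildFrom U P r D N k b (o.orSuccess s)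

end

inductive Answer
  | terminating
  | predictedTerminating
  | predictedNonTerminating

/-- `TPoLP U P Q r a`: the algorithm, run on `P`, `Q` and repetition number `r`, halts with the
answer `a`. -/
inductive TPoLP {L : FirstOrder.Language.{u, v}}
    (U : MguRule L) (P : Program L) (Q : Query L) (r : ℕ) :
    Answer → Prop
  | terminating (s : Bool) (h : Build U P r [] Q.modedRoot false (.done s false)) :
      TPoLP U P Q r .terminating
  | predictedTerminating (s : Bool) (h : Build U P r [] Q.modedRoot false (.done s true)) :
      TPoLP U P Q r .predictedTerminating
  | predictedNonTerminating (h : Build U P r [] Q.modedRoot false .stopped) :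
      TPoLP U P Q r .predictedNonTerminating

end TermPred

namespace TermPred

universe u v

variable {L : FirstOrder.Language.{u, v}}

/-! ## Substitutions -/

theorem Tm.subst_subst (θ δ : Subst L) (t : Tm L) :
    (t.subst θ).subst δ = t.subst fun x => (θ x).subst δ := by
  induction t with
  | var x => rfl
  | func f ts ih => simp only [FirstOrder.Language.Term.subst, ih]

theorem Tm.subst_congr {θ δ : Subst L} {t : Tm L} (h : ∀ x ∈ t.varFinset, θ x = δ x) :
    t.subst θ = t.subst δ := by
  induction t with
  | var x => exact h x (by simp [FirstOrder.Language.Term.varFinset])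
  | func f ts ih =>
    simp only [FirstOrder.Language.Term.subst]
    congr 1
    funext i
    exact ih i fun x hx => h x (by
      simp only [FirstOrder.Language.Term.varFinset, Finset.mem_biUnion]
      exact ⟨i, Finset.mem_univ i, hx⟩)

theorem Tm.eq_of_subst_eq {θ δ : Subst L} {t : Tm L} (h : t.subst θ = t.subst δ) :
    ∀ x ∈ t.varFinset, θ x = δ x := by
  induction t with
  | var y =>
    intro x hx
    simp only [FirstOrder.Language.Term.varFinset, Finset.mem_singleton] at hx
    subst hx
    exact h
  | func f ts ih =>
    intro x hx
    simp only [FirstOrder.Language.Term.varFinset, Finset.mem_biUnion] at hx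
    obtain ⟨i, -, hi⟩ := hx
    simp only [FirstOrder.Language.Term.subst, FirstOrder.Language.Term.func.injEq, heq_eq_eq,
      true_and] at h
    exact ih i (congrFun h i) x hi

@[simp]
theorem Tm.subst_var (t : Tm L) : t.subst (fun x => .var x) = t := by
  induction t with
  | var x => rfl
  | func f ts ih => simp only [FirstOrder.Language.Term.subst, ih]

theorem Tm.subst_of_ground {t : Tm L} (h : t.varFinset = ∅) (θ : Subst L) : t.subst θ = t := by
  conv_rhs => rw [← Tm.subst_var t]
  exact Tm.subst_congr fun x hx => by simp [h] at hx

theorem Tm.mem_varFinset_subst {θ : Subst L} {t : Tm L} {y : ℕ} :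
    y ∈ (t.subst θ).varFinset ↔ ∃ x ∈ t.varFinset, y ∈ (θ x).varFinset := by
  induction t with
  | var x => simp [FirstOrder.Language.Term.subst, FirstOrder.Language.Term.varFinset]
  | func f ts ih =>
    simp only [FirstOrder.Language.Term.subst, FirstOrder.Language.Term.varFinset,
      Finset.mem_biUnion, Finset.mem_univ, true_and, ih]
    exact ⟨fun ⟨i, x, hx, hy⟩ => ⟨x, ⟨i, hx⟩, hy⟩, fun ⟨x, ⟨i, hx⟩, hy⟩ => ⟨i, x, hx, hy⟩⟩

/-- The variables in the range of an idempotent substitution are unbound. -/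
theorem Subst.unbound_of_idem {θ : Subst L} (h : ∀ x, (θ x).subst θ = θ x) {x y : ℕ}
    (hy : y ∈ (θ x).varFinset) : θ y = .var y :=
  Tm.eq_of_subst_eq ((h x).trans (Tm.subst_var (θ x)).symm) y hy

/-- The number of occurrences of function symbols in a term. -/
def Tm.size : Tm L → ℕ
  | .var _ => 0
  | .func _ ts => 1 + ∑ i, Tm.size (ts i)

theorem sum_le_sum_sum {ι : Type*} {S : Finset ℕ} (s : Finset ι) (t : ι → Finset ℕ) (w : ℕ → ℕ)
    (h : S ⊆ s.biUnion t) : ∑ x ∈ S, w x ≤ ∑ i ∈ s, ∑ x ∈ t i, w x := by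
  classical
  refine (Finset.sum_le_sum_of_subset h).trans ?_
  clear h
  induction s using Finset.induction_on with
  | empty => simp
  | insert a s ha ih =>
    rw [Finset.biUnion_insert, Finset.sum_insert ha]
    have := Finset.sum_union_inter (s₁ := t a) (s₂ := s.biUnion t) (f := w)
    omega

theorem Tm.sum_size_le (σ : Subst L) (t : Tm L) :
    ∑ y ∈ t.varFinset, (σ y).size ≤ Tm.size (t.subst σ) := by
  induction t with
  | var x => simp [FirstOrder.Language.Term.subst, FirstOrder.Language.Term.varFinset]
  | func f ts ih =>
    simp only [FirstOrder.Language.Term.subst, FirstOrder.Language.Term.varFinset, Tm.size]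
    refine (sum_le_sum_sum _ _ _ subset_rfl).trans ?_
    exact (Finset.sum_le_sum fun i _ => ih i).trans (Nat.le_add_left _ _)

theorem Tm.sum_size_lt (σ : Subst L) {n : ℕ} (f : L.Functions n) (ts : Fin n → Tm L) :
    ∑ y ∈ (FirstOrder.Language.Term.func f ts).varFinset, (σ y).size <
      Tm.size ((FirstOrder.Language.Term.func f ts).subst σ) := by
  simp only [FirstOrder.Language.Term.subst, FirstOrder.Language.Term.varFinset, Tm.size]
  refine (sum_le_sum_sum _ _ _ subset_rfl).trans_lt ?_
  have := Finset.sum_le_sum fun i (_ : i ∈ Finset.univ) => Tm.sum_size_le σ (ts i)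
  omega

/-! ### Atoms, literals and clauses -/

namespace Atom

theorem mem_vars {A : Atom L} {x : ℕ} : x ∈ A.vars ↔ ∃ i, x ∈ (A.args i).varFinset := by
  simp [vars]

theorem subst_subst (θ δ : Subst L) (A : Atom L) :
    (A.subst θ).subst δ = A.subst fun x => (θ x).subst δ := by
  simp only [subst, Tm.subst_subst]

theorem subst_congr {θ δ : Subst L} {A : Atom L} (h : ∀ x ∈ A.vars, θ x = δ x) :
    A.subst θ = A.subst δ := by
  simp only [subst, mk.injEq, heq_eq_eq, true_and]
  funext i
  exact Tm.subst_congr fun x hx => h x (mem_vars.2 ⟨i, hx⟩)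

@[simp]
theorem subst_var (A : Atom L) : A.subst (fun x => .var x) = A := by
  simp only [subst, Tm.subst_var]

theorem subst_of_ground {A : Atom L} (h : A.vars = ∅) (θ : Subst L) : A.subst θ = A := by
  conv_rhs => rw [← subst_var A]
  exact subst_congr fun x hx => by simp [h] at hx

theorem mem_vars_subst {θ : Subst L} {A : Atom L} {y : ℕ} :
    y ∈ (A.subst θ).vars ↔ ∃ x ∈ A.vars, y ∈ (θ x).varFinset := by
  simp only [mem_vars]
  constructor
  · rintro ⟨i, hi⟩
    obtain ⟨x, hx, hy⟩ := Tm.mem_varFinset_subst.1 hi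
    exact ⟨x, ⟨i, hx⟩, hy⟩
  · rintro ⟨x, ⟨i, hx⟩, hy⟩
    exact ⟨i, Tm.mem_varFinset_subst.2 ⟨x, hx, hy⟩⟩

@[simp]
theorem predSym_subst (θ : Subst L) (A : Atom L) : (A.subst θ).predSym = A.predSym := rfl

end Atom

namespace Literal

@[simp]
theorem atom_subst (θ : Subst L) (l : Literal L) : (l.subst θ).atom = l.atom.subst θ := by
  cases l <;> rfl

theorem subst_subst (θ δ : Subst L) (l : Literal L) :
    (l.subst θ).subst δ = l.subst fun x => (θ x).subst δ := by
  cases l <;> simp only [subst, Atom.subst_subst]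

theorem subst_congr {θ δ : Subst L} {l : Literal L} (h : ∀ x ∈ l.atom.vars, θ x = δ x) :
    l.subst θ = l.subst δ := by
  cases l <;> exact congrArg _ (Atom.subst_congr h)

@[simp]
theorem subst_var (l : Literal L) : l.subst (fun x => .var x) = l := by
  cases l <;> simp [subst]

end Literal

namespace Clause

theorem mem_vars {C : Clause L} {x : ℕ} : x ∈ C.vars ↔ ∃ A ∈ C.atoms, x ∈ A.vars := by
  unfold vars
  induction C.atoms with
  | nil => simp
  | cons A l ih => simp [ih]

theorem mem_vars_of_mem_body {C : Clause L} {x : ℕ} {l : Literal L} (hl : l ∈ C.body)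
    (hx : x ∈ l.atom.vars) : x ∈ C.vars :=
  mem_vars.2 ⟨_, List.mem_cons_of_mem _ (List.mem_map_of_mem hl), hx⟩

theorem head_vars_subset (C : Clause L) : C.head.vars ⊆ C.vars :=
  fun _ hx => mem_vars.2 ⟨_, List.mem_cons_self, hx⟩

theorem notMem_fresh {C : Clause L} {used : Finset ℕ} {x : ℕ} (hx : x ∈ (C.fresh used).vars) :
    used.sup id + 1 ≤ x := by
  obtain ⟨A, hA, hxA⟩ := mem_vars.1 hx
  have : ∃ B : Atom L, A = B.subst fun x => .var (x + (used.sup id + 1)) := by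
    rcases List.mem_cons.1 hA with rfl | hA
    · exact ⟨C.head, rfl⟩
    · simp only [fresh, subst, List.map_map, List.mem_map] at hA
      obtain ⟨l, -, rfl⟩ := hA
      exact ⟨l.atom, by simp⟩
  obtain ⟨B, rfl⟩ := this
  obtain ⟨y, -, hy⟩ := Atom.mem_vars_subst.1 hxA
  simp only [FirstOrder.Language.Term.varFinset, Finset.mem_singleton] at hy
  omega

theorem disjoint_fresh (C : Clause L) (used : Finset ℕ) : Disjoint used (C.fresh used).vars := by
  refine Finset.disjoint_left.2 fun x hx hx' => ?_
  have := notMem_fresh hx'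
  have := Finset.le_sup (f := id) hx
  simp only [id] at this
  omega

end Clause

/-! ## Nodes -/

/-- The variable `x` occurs in the goal `G`. -/
def OccursIn (x : ℕ) (G : List (Subgoal L)) : Prop := ∃ s ∈ G, x ∈ s.lit.atom.vars

/-- The invariants of the nodes of a generalized SLDNF-tree. -/
structure Node.WF (N : Node L) : Prop where
  occurs : ∀ x, OccursIn x N.goal → x ∈ N.used
  inp : N.inp ⊆ N.used
  sub : N.sub = true → ∀ x ∈ N.inp, ¬ OccursIn x N.goal

theorem rootNode_wf {A : Atom L} {inp : Finset ℕ} (h : inp ⊆ A.vars) : (rootNode A inp).WF where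
  occurs x hx := by
    obtain ⟨s, hs, hx⟩ := hx
    simp only [rootNode, List.mem_singleton] at hs
    subst hs
    exact hx
  inp := h
  sub h := by simp [rootNode] at h

theorem Node.WF.isMgu {U : MguRule L} {N : Node L} (hN : N.WF) {A : Atom L} {anc : Finset ℕ}
    {rest : List (Subgoal L)} (hgoal : N.goal = ⟨.pos A, anc⟩ :: rest) {C : Clause L}
    (huni : ∃ τ, Unifies τ A (C.fresh N.used).head) :
    IsMgu N.inp A (C.fresh N.used).head (U.mgu N.inp A (C.fresh N.used).head) := by
  have hd := (C.disjoint_fresh N.used).mono_right (Clause.head_vars_subset _)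
  have hA : A.vars ⊆ N.used := fun x hx => hN.occurs x
    ⟨⟨.pos A, anc⟩, by rw [hgoal]; exact List.mem_cons_self, hx⟩
  exact U.spec _ _ _ (hd.mono_left hA) (hd.mono_left hN.inp) huni

/-- An input variable of the new goal stems from an input variable of the old one. -/
theorem ClauseStep.exists_inp {U : MguRule L} {P : Program L} {N N' : Node L} {k : ℕ} {θ : Subst L}
    (h : ClauseStep U P N k θ N') (hN : N.WF) {y : ℕ} (hy : y ∈ N'.inp)
    (ho : OccursIn y N'.goal) :
    ∃ x ∈ N.inp, OccursIn x N.goal ∧ y ∈ (θ x).varFinset := by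
  obtain ⟨A, anc, rest, C, θ, hgoal, hC, huni, hθ⟩ := h
  have hm := hN.isMgu (U := U) hgoal huni
  rw [← hθ] at hm
  have hd := C.disjoint_fresh N.used
  have hhead := Clause.head_vars_subset (C.fresh N.used)
  have hA : ∀ x ∈ A.vars, OccursIn x N.goal := fun x hx =>
    ⟨⟨.pos A, anc⟩, by rw [hgoal]; exact List.mem_cons_self, hx⟩
  have hz : ∃ z, (OccursIn z N.goal ∨ z ∈ (C.fresh N.used).vars) ∧ y ∈ (θ z).varFinset := by
    obtain ⟨s, hs, hy⟩ := ho
    rcases List.mem_append.1 hs with hs | hs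
    · obtain ⟨l, hl, rfl⟩ := List.mem_map.1 hs
      simp only [Literal.atom_subst] at hy
      obtain ⟨z, hz, hy⟩ := Atom.mem_vars_subst.1 hy
      exact ⟨z, Or.inr (Clause.mem_vars_of_mem_body hl hz), hy⟩
    · obtain ⟨t, ht, rfl⟩ := List.mem_map.1 hs
      simp only [Subgoal.subst, Literal.atom_subst] at hy
      obtain ⟨z, hz, hy⟩ := Atom.mem_vars_subst.1 hy
      exact ⟨z, Or.inl ⟨t, by rw [hgoal]; exact List.mem_cons_of_mem _ ht, hz⟩, hy⟩
  obtain ⟨z, hz, hyz⟩ := hz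
  have hold : y ∈ N.inp → ∃ x ∈ N.inp, OccursIn x N.goal ∧ y ∈ (θ x).varFinset := by
    intro hyi
    have hself : y ∈ (θ y).varFinset := by
      rw [Subst.unbound_of_idem hm.idem hyz]
      simp [FirstOrder.Language.Term.varFinset]
    have hynew : y ∉ (C.fresh N.used).vars := Finset.disjoint_left.1 hd (hN.inp hyi)
    refine ⟨y, hyi, ?_, hself⟩
    by_cases hzm : z ∈ A.vars ∪ (C.fresh N.used).head.vars
    · rcases Finset.mem_union.1 (hm.range z hzm hyz) with h | h
      · exact hA y h
      · exact absurd (hhead h) hynew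
    · rw [hm.relevant z hzm] at hyz
      simp only [FirstOrder.Language.Term.varFinset, Finset.mem_singleton] at hyz
      subst hyz
      exact hz.resolve_right hynew
  simp only [Finset.mem_union, Finset.mem_biUnion] at hy
  rcases hy with hy | ⟨x, hx, hyx⟩
  · exact hold hy
  · by_cases hxA : x ∈ A.vars
    · exact ⟨x, hx, hA x hxA, hyx⟩
    · have hxm : x ∉ A.vars ∪ (C.fresh N.used).head.vars := by
        rw [Finset.mem_union, not_or]
        exact ⟨hxA, fun h => Finset.disjoint_left.1 hd (hN.inp hx) (hhead h)⟩
      rw [hm.relevant x hxm] at hyx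
      simp only [FirstOrder.Language.Term.varFinset, Finset.mem_singleton] at hyx
      subst hyx
      exact hold hx

/-- A bound input variable occurs in the goal. -/
theorem ClauseStep.occursIn_of_bound {U : MguRule L} {P : Program L} {N N' : Node L} {k : ℕ}
    {θ : Subst L} (h : ClauseStep U P N k θ N') (hN : N.WF) {x : ℕ} (hx : x ∈ N.inp)
    (hb : θ x ≠ .var x) : OccursIn x N.goal := by
  obtain ⟨A, anc, rest, C, θ, hgoal, hC, huni, hθ⟩ := h
  have hm := hN.isMgu (U := U) hgoal huni
  rw [← hθ] at hm
  have hxm : x ∈ A.vars ∪ (C.fresh N.used).head.vars := by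
    by_contra hxm
    exact hb (hm.relevant x hxm)
  rcases Finset.mem_union.1 hxm with h | h
  · exact ⟨⟨.pos A, anc⟩, by rw [hgoal]; exact List.mem_cons_self, h⟩
  · exact absurd (Clause.head_vars_subset _ h)
      (Finset.disjoint_left.1 (C.disjoint_fresh N.used) (hN.inp hx))

theorem ClauseStep.wf {U : MguRule L} {P : Program L} {N N' : Node L} {k : ℕ} {θ : Subst L}
    (h : ClauseStep U P N k θ N') (hN : N.WF) : N'.WF := by
  have hsub : N'.sub = true → ∀ x ∈ N'.inp, ¬ OccursIn x N'.goal := by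
    intro hs y hy ho
    obtain ⟨x, hx, hxo, -⟩ := h.exists_inp hN hy ho
    refine hN.sub ?_ x hx hxo
    cases h
    exact hs
  obtain ⟨A, anc, rest, C, θ, hgoal, hC, huni, hθ⟩ := h
  have hm := hN.isMgu (U := U) hgoal huni
  rw [← hθ] at hm
  have hhead := Clause.head_vars_subset (C.fresh N.used)
  have hA : A.vars ⊆ N.used := fun x hx => hN.occurs x
    ⟨⟨.pos A, anc⟩, by rw [hgoal]; exact List.mem_cons_self, hx⟩
  have hrange : ∀ z ∈ N.used ∪ (C.fresh N.used).vars, (θ z).varFinset ⊆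
      N.used ∪ (C.fresh N.used).vars := by
    intro z hz
    by_cases hzm : z ∈ A.vars ∪ (C.fresh N.used).head.vars
    · exact (hm.range z hzm).trans (Finset.union_subset_union hA hhead)
    · rw [hm.relevant z hzm]
      simpa [FirstOrder.Language.Term.varFinset] using hz
  refine ⟨?_, ?_, hsub⟩
  · rintro y ⟨s, hs, hy⟩
    rcases List.mem_append.1 hs with hs | hs
    · obtain ⟨l, hl, rfl⟩ := List.mem_map.1 hs
      simp only [Literal.atom_subst] at hy
      obtain ⟨z, hz, hy⟩ := Atom.mem_vars_subst.1 hy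
      exact hrange z (Finset.mem_union_right _ (Clause.mem_vars_of_mem_body hl hz)) hy
    · obtain ⟨t, ht, rfl⟩ := List.mem_map.1 hs
      simp only [Subgoal.subst, Literal.atom_subst] at hy
      obtain ⟨z, hz, hy⟩ := Atom.mem_vars_subst.1 hy
      refine hrange z (Finset.mem_union_left _ (hN.occurs z ⟨t, ?_, hz⟩)) hy
      rw [hgoal]
      exact List.mem_cons_of_mem _ ht
  · intro y hy
    simp only [Finset.mem_union, Finset.mem_biUnion] at hy
    rcases hy with hy | ⟨x, hx, hy⟩
    · exact Finset.mem_union_left _ (hN.inp hy)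
    · exact hrange x (Finset.mem_union_left _ (hN.inp hx)) hy

theorem NegStep.wf_left {N M N' : Node L} (h : NegStep N M N') (hN : N.WF) : M.WF := by
  obtain ⟨A, anc, rest, hgoal, hground⟩ := h
  have ho : ∀ x, ¬ OccursIn x [(⟨.pos A, anc⟩ : Subgoal L)] := by
    rintro x ⟨s, hs, hx⟩
    simp only [List.mem_singleton] at hs
    subst hs
    simp [Literal.atom, hground] at hx
  exact ⟨fun x hx => absurd hx (ho x), hN.inp, fun _ x _ => ho x⟩

theorem NegStep.wf_right {N M N' : Node L} (h : NegStep N M N') (hN : N.WF) : N'.WF := by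
  obtain ⟨A, anc, rest, hgoal, hground⟩ := h
  have ho : ∀ x, OccursIn x rest → OccursIn x N.goal := by
    rintro x ⟨s, hs, hx⟩
    exact ⟨s, by rw [hgoal]; exact List.mem_cons_of_mem _ hs, hx⟩
  exact ⟨fun x hx => hN.occurs x (ho x hx), hN.inp,
    fun hs x hx hxo => hN.sub hs x hx (ho x hxo)⟩

/-! ## Lifting -/

/-- The goal `G` is the instance of the goal `H` by `σ`. -/
def InstBy (σ : Subst L) (G H : List (Subgoal L)) : Prop :=
  G.map Subgoal.lit = H.map fun s => s.lit.subst σ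

theorem ClauseStep.lift {U U' : MguRule L} {P : Program L} {N N' M : Node L} {k : ℕ}
    {θ σ : Subst L} (h : ClauseStep U P N k θ N') (hN : N.WF) (hM : M.WF)
    (hσ : InstBy σ N.goal M.goal) :
    ∃ θ' M' δ, ClauseStep U' P M k θ' M' ∧ InstBy δ N'.goal M'.goal ∧
      ∀ x ∈ M.used, (σ x).subst θ = (θ' x).subst δ := by
  obtain ⟨A, anc, rest, C, θ, hgoal, hC, huni, hθ⟩ := h
  have hm := hN.isMgu (U := U) hgoal huni
  rw [← hθ] at hm
  obtain ⟨s, restM, hgoalM⟩ : ∃ s restM, M.goal = s :: restM := by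
    rcases hM : M.goal with _ | ⟨s, restM⟩
    · simp [InstBy, hgoal, hM] at hσ
    · exact ⟨_, _, rfl⟩
  simp only [InstBy, hgoal, hgoalM, List.map_cons, List.cons.injEq] at hσ
  obtain ⟨hσA, hσrest⟩ := hσ
  obtain ⟨B, ancM, rfl, rfl⟩ : ∃ B ancM, s = ⟨.pos B, ancM⟩ ∧ A = B.subst σ := by
    obtain ⟨l, ancM⟩ := s
    cases l with
    | pos B => exact ⟨B, ancM, rfl, by simpa [Literal.subst] using hσA⟩
    | neg B => simp [Literal.subst] at hσA
  set b := M.used.sup id + 1 with hb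
  set a := N.used.sup id + 1 with ha
  let ρ : Subst L := fun y => if y < b then (σ y).subst θ else θ (y - b + a)
  have hρold : ∀ x ∈ M.used, ρ x = (σ x).subst θ := by
    intro x hx
    have := Finset.le_sup (f := id) hx
    simp only [id] at this
    exact if_pos (by omega)
  have hρnew : (fun x => FirstOrder.Language.Term.subst (.var (x + b)) ρ) =
      fun x => FirstOrder.Language.Term.subst (.var (x + a)) θ := by
    funext x
    simp [FirstOrder.Language.Term.subst, ρ]
  have hocc : ∀ s ∈ M.goal, ∀ x ∈ s.lit.atom.vars, ρ x = (σ x).subst θ := fun s hs x hx =>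
    hρold x (hM.occurs x ⟨s, hs, hx⟩)
  have huniM : Unifies ρ B (C.fresh M.used).head := by
    have h1 : B.subst ρ = (B.subst σ).subst θ := by
      rw [Atom.subst_subst]
      refine Atom.subst_congr fun x hx => hocc ⟨.pos B, ancM⟩ ?_ x hx
      rw [hgoalM]
      exact List.mem_cons_self
    have h2 : (C.fresh M.used).head.subst ρ = (C.fresh N.used).head.subst θ := by
      simp only [Clause.fresh, Clause.subst, Atom.subst_subst]
      rw [← hb, ← ha, hρnew]
    exact h1.trans (hm.unifies.trans h2.symm)
  have hmM := hM.isMgu (U := U') hgoalM ⟨ρ, huniM⟩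
  obtain ⟨δ, hδ⟩ := hmM.general ρ huniM
  refine ⟨_, _, δ, ClauseStep.intro B ancM restM C _ hgoalM hC ⟨ρ, huniM⟩ rfl, ?_,
    fun x hx => (hρold x hx).symm.trans (hδ x)⟩
  have hδ' : (fun x => (U'.mgu M.inp B (C.fresh M.used).head x).subst δ) = ρ :=
    funext fun x => (hδ x).symm
  simp only [InstBy, List.map_append, List.map_map]
  congr 1
  · simp only [Clause.fresh, Clause.subst, List.map_map]
    refine List.map_congr_left fun l _ => ?_
    simp only [Function.comp_apply, Literal.subst_subst]
    rw [← hb, ← ha]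
    rw [← hρnew]
    simp only [← hδ', Tm.subst_subst]
    rfl
  · have : rest.map (Subgoal.lit ∘ Subgoal.subst θ) =
        (rest.map Subgoal.lit).map (Literal.subst θ) := by
      rw [List.map_map]; rfl
    rw [this, hσrest, List.map_map]
    refine List.map_congr_left fun s hs => ?_
    simp only [Function.comp_apply, Subgoal.subst, Literal.subst_subst, hδ']
    refine (Literal.subst_congr fun x hx => hocc s ?_ x hx).symm
    rw [hgoalM]
    exact List.mem_cons_of_mem _ hs

theorem ClauseStep.unique {U : MguRule L} {P : Program L} {N N₁ N₂ : Node L} {k : ℕ}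
    {θ₁ θ₂ : Subst L} (h₁ : ClauseStep U P N k θ₁ N₁) (h₂ : ClauseStep U P N k θ₂ N₂) :
    θ₁ = θ₂ ∧ N₁ = N₂ := by
  obtain ⟨A, anc, rest, C, θ, hgoal, hC, huni, hθ⟩ := h₁
  obtain ⟨A', anc', rest', C', θ', hgoal', hC', huni', hθ'⟩ := h₂
  rw [hgoal] at hgoal'
  rw [hC] at hC'
  simp only [List.cons.injEq, Subgoal.mk.injEq, Literal.pos.injEq] at hgoal'
  obtain ⟨⟨rfl, rfl⟩, rfl⟩ := hgoal'
  obtain rfl := Option.some.inj hC'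
  rw [← hθ] at hθ'
  subst hθ'
  exact ⟨rfl, rfl⟩

theorem NegStep.unique {N M₁ M₂ N₁ N₂ : Node L} (h₁ : NegStep N M₁ N₁) (h₂ : NegStep N M₂ N₂) :
    M₁ = M₂ ∧ N₁ = N₂ := by
  obtain ⟨A, anc, rest, hgoal, hg⟩ := h₁
  obtain ⟨A', anc', rest', hgoal', hg'⟩ := h₂
  rw [hgoal] at hgoal'
  simp only [List.cons.injEq, Subgoal.mk.injEq, Literal.neg.injEq] at hgoal'
  obtain ⟨⟨rfl, rfl⟩, rfl⟩ := hgoal'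
  exact ⟨rfl, rfl⟩

/-- Lifting of a step at a negative subgoal that is already ground in the more general goal. -/
theorem NegStep.lift {N K N' M : Node L} {σ : Subst L} (h : NegStep N K N')
    (hσ : InstBy σ N.goal M.goal)
    (hM : ∀ A anc rest, M.goal = ⟨.neg A, anc⟩ :: rest → A.vars = ∅) :
    ∃ K' M', NegStep M K' M' ∧ K.goal.map Subgoal.lit = K'.goal.map Subgoal.lit ∧
      InstBy σ N'.goal M'.goal := by
  obtain ⟨A, anc, rest, hgoal, hground⟩ := h
  obtain ⟨s, restM, hgoalM⟩ : ∃ s restM, M.goal = s :: restM := by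
    rcases hM : M.goal with _ | ⟨s, restM⟩
    · simp [InstBy, hgoal, hM] at hσ
    · exact ⟨_, _, rfl⟩
  simp only [InstBy, hgoal, hgoalM, List.map_cons, List.cons.injEq] at hσ
  obtain ⟨hσA, hσrest⟩ := hσ
  obtain ⟨B, ancM, rfl, rfl⟩ : ∃ B ancM, s = ⟨.neg B, ancM⟩ ∧ A = B.subst σ := by
    obtain ⟨l, ancM⟩ := s
    cases l with
    | neg B => exact ⟨B, ancM, rfl, by simpa [Literal.subst] using hσA⟩
    | pos B => simp [Literal.subst] at hσA
  have hB := hM _ _ _ hgoalM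
  exact ⟨_, _, .intro B ancM restM hgoalM hB, by simp [Atom.subst_of_ground hB], hσrest⟩

/-! ## Success and finite failure -/

/-- The goals of the two nodes are instances of each other. -/
def Variant (N M : Node L) : Prop := ∃ σ τ, InstBy σ N.goal M.goal ∧ InstBy τ M.goal N.goal

theorem Variant.symm {N M : Node L} (h : Variant N M) : Variant M N :=
  let ⟨σ, τ, h₁, h₂⟩ := h
  ⟨τ, σ, h₂, h₁⟩

theorem Variant.of_lit_eq {N M : Node L}
    (h : N.goal.map Subgoal.lit = M.goal.map Subgoal.lit) : Variant N M :=
  ⟨fun x => .var x, fun x => .var x, by simp [InstBy, h], by simp [InstBy, h]⟩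

theorem Variant.clauseStep {U U' : MguRule L} {P : Program L} {N N' M : Node L} {k : ℕ}
    {θ : Subst L} (hv : Variant N M) (hN : N.WF) (hM : M.WF) (h : ClauseStep U P N k θ N') :
    ∃ θ' M', ClauseStep U' P M k θ' M' ∧ Variant N' M' := by
  obtain ⟨σ, τ, hσ, hτ⟩ := hv
  obtain ⟨θ', M', δ, hs, hδ, -⟩ := h.lift (U' := U') hN hM hσ
  obtain ⟨θ'', N'', ε, hs', hε, -⟩ := hs.lift (U' := U) hM hN hτ
  obtain ⟨rfl, rfl⟩ := h.unique hs'
  exact ⟨θ', M', hs, δ, ε, hδ, hε⟩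

theorem Variant.negStep {N K N' M : Node L} (hv : Variant N M) (h : NegStep N K N') :
    ∃ K' M', NegStep M K' M' ∧ Variant K K' ∧ Variant N' M' := by
  obtain ⟨σ, τ, hσ, hτ⟩ := hv
  have hground : ∀ A anc rest, M.goal = ⟨.neg A, anc⟩ :: rest → A.vars = ∅ := by
    intro B anc restM hgoalM
    obtain ⟨A, anc, rest, hgoal, hg⟩ := h
    simp only [InstBy, hgoal, hgoalM, List.map_cons, List.cons.injEq, Literal.subst,
      Literal.neg.injEq] at hτ
    rw [hτ.1, Atom.subst_of_ground hg, hg]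
  obtain ⟨K', M', hs, hK, hσ'⟩ := h.lift hσ hground
  have hground' : ∀ A anc rest, N.goal = ⟨.neg A, anc⟩ :: rest → A.vars = ∅ := by
    intro B anc restN hgoalN
    obtain ⟨A, anc, rest, hgoal, hg⟩ := h
    rw [hgoal] at hgoalN
    simp only [List.cons.injEq, Subgoal.mk.injEq, Literal.neg.injEq] at hgoalN
    rw [← hgoalN.1.1, hg]
  obtain ⟨K'', N'', hs', -, hτ'⟩ := hs.lift hτ hground'
  obtain ⟨rfl, rfl⟩ := h.unique hs'
  exact ⟨K', M', hs, .of_lit_eq hK, σ, τ, hσ', hτ'⟩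

theorem Variant.goal_eq_nil {N M : Node L} (hv : Variant N M) (h : N.goal = []) :
    M.goal = [] := by
  obtain ⟨σ, τ, hσ, hτ⟩ := hv
  simpa [InstBy, h] using hτ

theorem Variant.goal_pos {N M : Node L} (hv : Variant N M) {A : Atom L} {anc : Finset ℕ}
    {rest : List (Subgoal L)} (h : N.goal = ⟨.pos A, anc⟩ :: rest) :
    ∃ B anc' rest', M.goal = ⟨.pos B, anc'⟩ :: rest' := by
  obtain ⟨σ, τ, hσ, hτ⟩ := hv
  rcases hM : M.goal with _ | ⟨⟨l, anc'⟩, restM⟩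
  · simp [InstBy, h, hM] at hτ
  · cases l with
    | pos B => exact ⟨_, _, _, rfl⟩
    | neg B => simp [InstBy, h, hM, Literal.subst] at hτ

mutual

theorem Succeeds.variant {U U' : MguRule L} {P : Program L} {N M : Node L}
    (h : Succeeds U P N) (hv : Variant N M) (hN : N.WF) (hM : M.WF) : Succeeds U' P M :=
  match h with
  | .empty _ h => .empty _ (hv.goal_eq_nil h)
  | .clause _ _ _ _ h h' => by
    obtain ⟨θ', M', hs, hv'⟩ := hv.clauseStep (U' := U') hN hM h
    exact .clause _ _ _ _ hs (h'.variant hv' (h.wf hN) (hs.wf hM))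
  | .naf _ _ _ h hK h' => by
    obtain ⟨K', M', hs, hvK, hv'⟩ := hv.negStep h
    exact .naf _ _ _ hs (hK.variant hvK (h.wf_left hN) (hs.wf_left hM))
      (h'.variant hv' (h.wf_right hN) (hs.wf_right hM))

theorem FinFails.variant {U U' : MguRule L} {P : Program L} {N M : Node L}
    (h : FinFails U P N) (hv : Variant N M) (hN : N.WF) (hM : M.WF) : FinFails U' P M :=
  match h with
  | .clause _ A anc rest hgoal h => by
    obtain ⟨B, anc', rest', hB⟩ := hv.goal_pos hgoal
    refine .clause _ B anc' rest' hB fun k θ M' hs => ?_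
    obtain ⟨θ', N', hs', hv'⟩ := hv.symm.clauseStep (U' := U) hM hN hs
    exact (h k θ' N' hs').variant hv'.symm (hs'.wf hN) (hs.wf hM)
  | .neg _ _ _ h hK => by
    obtain ⟨K', M', hs, hvK, hv'⟩ := hv.negStep h
    exact .neg _ _ _ hs (hK.variant hvK (h.wf_left hN) (hs.wf_left hM))
  | .naf _ _ _ h hK h' => by
    obtain ⟨K', M', hs, hvK, hv'⟩ := hv.negStep h
    exact .naf _ _ _ hs (hK.variant hvK (h.wf_left hN) (hs.wf_left hM))
      (h'.variant hv' (h.wf_right hN) (hs.wf_right hM))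

end

theorem ClauseStep.not_negStep {U : MguRule L} {P : Program L} {N N' K M : Node L} {k : ℕ}
    {θ : Subst L} (h : ClauseStep U P N k θ N') (h' : NegStep N K M) : False := by
  obtain ⟨A, anc, rest, C, θ, hgoal, -, -, -⟩ := h
  obtain ⟨A', anc', rest', hgoal', -⟩ := h'
  simp [hgoal] at hgoal'

mutual

theorem Succeeds.not_finFails {U : MguRule L} {P : Program L} {N : Node L}
    (h : Succeeds U P N) (h' : FinFails U P N) : False :=
  match h with
  | .empty _ h => by
    cases h' with
    | clause _ A anc rest hgoal => simp [h] at hgoal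
    | neg _ M N' hs => cases hs; simp_all
    | naf _ M N' hs => cases hs; simp_all
  | .clause _ _ _ _ hs hN' => by
    cases h' with
    | clause _ A anc rest hgoal h => exact hN'.not_finFails (h _ _ _ hs)
    | neg _ M N' hs' => exact hs.not_negStep hs'
    | naf _ M N' hs' => exact hs.not_negStep hs'
  | .naf _ M N' hs hM hN' => by
    cases h' with
    | clause _ A anc rest hgoal h => cases hs; simp_all
    | neg _ M' N'' hs' hM' =>
      obtain ⟨rfl, rfl⟩ := hs.unique hs'
      exact hM.not_succeeds hM'
    | naf _ M' N'' hs' _ hN'' =>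
      obtain ⟨rfl, rfl⟩ := hs.unique hs'
      exact hN'.not_finFails hN''

theorem FinFails.not_succeeds {U : MguRule L} {P : Program L} {N : Node L}
    (h : FinFails U P N) (h' : Succeeds U P N) : False :=
  match h with
  | .clause _ A anc rest hgoal h => by
    cases h' with
    | empty _ h => simp [h] at hgoal
    | clause _ k θ N' hs hN' => exact (h _ _ _ hs).not_succeeds hN'
    | naf _ M N' hs => cases hs; simp_all
  | .neg _ M N' hs hM => by
    cases h' with
    | empty _ h => cases hs; simp_all
    | clause _ k θ N' hs' => exact hs'.not_negStep hs
    | naf _ M' N'' hs' hM' =>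
      obtain ⟨rfl, rfl⟩ := hs.unique hs'
      exact hM.not_finFails hM'
  | .naf _ M N' hs hM hN' => by
    cases h' with
    | empty _ h => cases hs; simp_all
    | clause _ k θ N' hs' => exact hs'.not_negStep hs
    | naf _ M' N'' hs' hM' hN'' =>
      obtain ⟨rfl, rfl⟩ := hs.unique hs'
      exact hN'.not_succeeds hN''

end

/-! ## Derivations with labelled edges -/

/-- `Child` with the label of the edge. -/
inductive Step (U : MguRule L) (P : Program L) (N : Node L) : Edge L → Node L → Prop
  | clause (k : ℕ) (θ : Subst L) (N' : Node L) (h : ClauseStep U P N k θ N')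
      (hprune : N.sub = true → ∀ j < k, ∀ θ' N'', ClauseStep U P N j θ' N'' →
        ¬ Succeeds U P N'') : Step U P N (.clause k θ) N'
  | arc (M N' : Node L) (h : NegStep N M N') : Step U P N .arc M
  | naf (M N' : Node L) (h : NegStep N M N') (hM : FinFails U P M) : Step U P N .naf N'

theorem Step.child {U : MguRule L} {P : Program L} {N N' : Node L} {e : Edge L}
    (h : Step U P N e N') : Child U P N N' := by
  cases h with
  | clause k θ N' h hprune => exact .clause k θ _ h hprune
  | arc M N' h => exact .arc _ N' h
  | naf M N' h hM => exact .naf M _ h hM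

theorem Child.exists_step {U : MguRule L} {P : Program L} {N N' : Node L}
    (h : Child U P N N') : ∃ e, Step U P N e N' := by
  cases h with
  | clause k θ N' h hprune => exact ⟨_, .clause k θ _ h hprune⟩
  | arc M N' h => exact ⟨_, .arc _ N' h⟩
  | naf M N' h hM => exact ⟨_, .naf M _ h hM⟩

theorem Step.clauseStep {U : MguRule L} {P : Program L} {N N' : Node L} {k : ℕ} {θ : Subst L}
    (h : Step U P N (.clause k θ) N') : ClauseStep U P N k θ N' := by
  cases h with
  | clause _ _ _ h => exact h

theorem ClauseStep.exists_goal {U : MguRule L} {P : Program L} {N N' : Node L} {k : ℕ}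
    {θ : Subst L} (h : ClauseStep U P N k θ N') :
    ∃ A anc rest B, N.goal = ⟨.pos A, anc⟩ :: rest ∧
      N'.goal = B ++ rest.map (Subgoal.subst θ) ∧ ∀ s ∈ B, s.anc = insert N.depth anc := by
  obtain ⟨A, anc, rest, C, θ, hgoal, hC, huni, hθ⟩ := h
  refine ⟨A, anc, rest, _, hgoal, rfl, fun s hs => ?_⟩
  obtain ⟨l, -, rfl⟩ := List.mem_map.1 hs
  rfl

theorem Step.wf {U : MguRule L} {P : Program L} {N N' : Node L} {e : Edge L}
    (h : Step U P N e N') (hN : N.WF) : N'.WF := by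
  cases h with
  | clause k θ N' h hprune => exact h.wf hN
  | arc M N' h => exact h.wf_left hN
  | naf M N' h hM => exact h.wf_right hN

theorem Step.depth {U : MguRule L} {P : Program L} {N N' : Node L} {e : Edge L}
    (h : Step U P N e N') : N'.depth = N.depth + 1 := by
  cases h with
  | clause k θ N' h hprune => cases h; rfl
  | arc M N' h => cases h; rfl
  | naf M N' h hM => cases h; rfl

theorem Step.inp_subset {U : MguRule L} {P : Program L} {N N' : Node L} {e : Edge L}
    (h : Step U P N e N') : N.inp ⊆ N'.inp := by
  cases h with
  | clause k θ N' h hprune => cases h; exact Finset.subset_union_left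
  | arc M N' h => cases h; rfl
  | naf M N' h hM => cases h; rfl

/-! ## The function symbols of a derivation -/

/-- All function symbols of the term belong to `F`. -/
def Tm.Over (F : Set (Σ n, L.Functions n)) : Tm L → Prop
  | .var _ => True
  | @FirstOrder.Language.Term.func _ _ n f ts => ⟨n, f⟩ ∈ F ∧ ∀ i, Tm.Over F (ts i)

open Classical in
/-- The term with all subterms whose function symbol does not belong to `F` cut off. -/
noncomputable def Tm.confine (F : Set (Σ n, L.Functions n)) : Tm L → Tm L
  | .var x => .var x
  | @FirstOrder.Language.Term.func _ _ n f ts =>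
    if (⟨n, f⟩ : Σ n, L.Functions n) ∈ F then .func f fun i => Tm.confine F (ts i) else .var 0

namespace Tm

variable {F : Set (Σ n, L.Functions n)}

theorem over_confine (t : Tm L) : Over F (confine F t) := by
  induction t with
  | var x => trivial
  | func f ts ih =>
    rw [confine]
    split_ifs with h
    · exact ⟨h, ih⟩
    · trivial

theorem confine_subst {t : Tm L} (ht : Over F t) (θ : Subst L) :
    confine F (t.subst θ) = t.subst fun x => confine F (θ x) := by
  induction t with
  | var x => rfl
  | func f ts ih =>
    simp only [FirstOrder.Language.Term.subst, confine, if_pos ht.1]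
    congr 1
    funext i
    exact ih i (ht.2 i)

theorem Over.subst {t : Tm L} (ht : Over F t) {θ : Subst L} (hθ : ∀ x, Over F (θ x)) :
    Over F (t.subst θ) := by
  induction t with
  | var x => exact hθ x
  | func f ts ih => exact ⟨ht.1, fun i => ih i (ht.2 i)⟩

theorem Over.of_subst {t : Tm L} {θ : Subst L} (ht : Over F (t.subst θ)) : Over F t := by
  induction t with
  | var x => trivial
  | func f ts ih => exact ⟨ht.1, fun i => ih i (ht.2 i)⟩

theorem over_of_sym {t : Tm L} (h : ∀ f, Sym.fn f ∈ symTerm t → f ∈ F) : Over F t := by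
  induction t with
  | var x => trivial
  | func f ts ih =>
    refine ⟨h _ (by simp [symTerm]), fun i => ih i fun g hg => h g ?_⟩
    rw [symTerm]
    refine List.mem_cons_of_mem _ (List.mem_flatten.2 ⟨_, ?_, hg⟩)
    exact List.mem_ofFn.2 ⟨i, rfl⟩

theorem Over.sym {t : Tm L} (ht : Over F t) : ∀ s ∈ symTerm t, s ∈ insert Sym.X (Sym.fn '' F) := by
  induction t with
  | var x =>
    intro s hs
    simp only [symTerm, List.mem_singleton] at hs
    exact Or.inl hs
  | func f ts ih =>
    intro s hs
    rw [symTerm] at hs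
    rcases List.mem_cons.1 hs with rfl | hs
    · exact Or.inr ⟨_, ht.1, rfl⟩
    · obtain ⟨l, hl, hs⟩ := List.mem_flatten.1 hs
      obtain ⟨i, rfl⟩ := List.mem_ofFn.1 hl
      exact ih i (ht.2 i) s hs

end Tm

/-- All function symbols of the atom belong to `F`. -/
def Atom.Over (F : Set (Σ n, L.Functions n)) (A : Atom L) : Prop := ∀ i, (A.args i).Over F

theorem IsMgu.over {F : Set (Σ n, L.Functions n)} {inp : Finset ℕ} {A B : Atom L} {θ : Subst L}
    (h : IsMgu inp A B θ) (hA : A.Over F) (hB : B.Over F) (x : ℕ) : (θ x).Over F := by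
  have key : ∀ {A : Atom L}, A.Over F → A.subst (fun x => (θ x).confine F) =
      ⟨(A.subst θ).arity, (A.subst θ).pred, fun i => ((A.subst θ).args i).confine F⟩ := by
    intro A hA
    simp only [Atom.subst, Atom.mk.injEq, heq_eq_eq, true_and]
    exact funext fun i => (Tm.confine_subst (hA i) θ).symm
  have hu : Unifies (fun x => (θ x).confine F) A B := by
    have hθ : A.subst θ = B.subst θ := h.unifies
    rw [Unifies, key hA, key hB, hθ]
  obtain ⟨δ, hδ⟩ := h.general _ hu
  have := Tm.over_confine (F := F) (θ x)
  rw [hδ x] at this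
  exact this.of_subst

theorem Atom.Over.subst {F : Set (Σ n, L.Functions n)} {A : Atom L} (hA : A.Over F) {θ : Subst L}
    (hθ : ∀ x, (θ x).Over F) : (A.subst θ).Over F := fun i => (hA i).subst hθ

/-- All function symbols of the goal belong to `F`. -/
def GoalOver (F : Set (Σ n, L.Functions n)) (G : List (Subgoal L)) : Prop :=
  ∀ s ∈ G, s.lit.atom.Over F

theorem Step.goalOver {F : Set (Σ n, L.Functions n)} {U : MguRule L} {P : Program L}
    {N N' : Node L} {e : Edge L} (h : Step U P N e N') (hN : N.WF)
    (hP : ∀ C ∈ P, ∀ A ∈ C.atoms, A.Over F) (hG : GoalOver F N.goal) : GoalOver F N'.goal := by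
  cases h with
  | clause k θ N' h hprune =>
    obtain ⟨A, anc, rest, C, θ, hgoal, hC, huni, hθ⟩ := h
    have hm := hN.isMgu (U := U) hgoal huni
    rw [← hθ] at hm
    rw [hgoal] at hG
    have hC' := hP C (List.mem_of_getElem? hC)
    have hvar : ∀ x : ℕ, Tm.Over F ((FirstOrder.Language.Term.var
        (x + (N.used.sup id + 1)) : Tm L)) := fun _ => trivial
    have hover := hm.over (hG _ List.mem_cons_self)
      ((hC' _ List.mem_cons_self).subst (θ := fun x => .var (x + (N.used.sup id + 1))) hvar)
    intro s hs
    rcases List.mem_append.1 hs with hs | hs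
    · obtain ⟨l, hl, rfl⟩ := List.mem_map.1 hs
      obtain ⟨l', hl', rfl⟩ := List.mem_map.1 hl
      simp only [Literal.atom_subst]
      exact ((hC' _ (List.mem_cons_of_mem _ (List.mem_map_of_mem hl'))).subst hvar).subst hover
    · obtain ⟨t, ht, rfl⟩ := List.mem_map.1 hs
      simp only [Subgoal.subst, Literal.atom_subst]
      exact (hG t (List.mem_cons_of_mem _ ht)).subst hover
  | arc M N' h =>
    obtain ⟨A, anc, rest, hgoal, -⟩ := h
    rw [hgoal] at hG
    intro s hs
    simp only [List.mem_singleton] at hs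
    subst hs
    exact hG ⟨.neg A, anc⟩ List.mem_cons_self
  | naf M N' h hM =>
    obtain ⟨A, anc, rest, hgoal, -⟩ := h
    rw [hgoal] at hG
    exact fun s hs => hG s (List.mem_cons_of_mem _ hs)

/-- The arguments part of the symbol string of an atom. -/
def Atom.argSym (A : Atom L) : List (Sym L) := (List.ofFn fun i => symTerm (A.args i)).flatten

theorem Atom.sym_eq (A : Atom L) : A.sym = Sym.pred A.predSym :: A.argSym := rfl

theorem Atom.Over.argSym {F : Set (Σ n, L.Functions n)} {A : Atom L} (hA : A.Over F) :
    ∀ s ∈ A.argSym, s ∈ insert Sym.X (Sym.fn '' F) := by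
  intro s hs
  obtain ⟨l, hl, hs⟩ := List.mem_flatten.1 hs
  obtain ⟨i, rfl⟩ := List.mem_ofFn.1 hl
  exact (hA i).sym s hs

/-- The function symbols in a list of atoms. -/
def fnSyms (l : List (Atom L)) : Set (Σ n, L.Functions n) := {f | ∃ A ∈ l, Sym.fn f ∈ A.argSym}

theorem finite_fnSyms (l : List (Atom L)) : (fnSyms l).Finite := by
  have : (Sym.fn ⁻¹' {s | s ∈ l.flatMap Atom.argSym} : Set (Σ n, L.Functions n)).Finite :=
    (List.finite_toSet _).preimage fun a _ b _ h => Sym.fn.inj h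
  refine this.subset fun f hf => ?_
  obtain ⟨A, hA, hf⟩ := hf
  exact List.mem_flatMap.2 ⟨A, hA, hf⟩

theorem over_fnSyms {l : List (Atom L)} {A : Atom L} (hA : A ∈ l) : A.Over (fnSyms l) :=
  fun i => Tm.over_of_sym fun _ hf =>
    ⟨A, hA, List.mem_flatten.2 ⟨_, List.mem_ofFn.2 ⟨i, rfl⟩, hf⟩⟩

/-! ## Infinite derivations contain loops -/

/-- The prefix of length `n` of an infinite derivation. -/
def pathTo (N : ℕ → Node L) (e : ℕ → Edge L) (n : ℕ) : Path L :=
  (List.range n).map fun j => (N j, e j)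

theorem pathTo_getElem? (N : ℕ → Node L) (e : ℕ → Edge L) {n j : ℕ} (h : j < n) :
    (pathTo N e n)[j]? = some (N j, e j) := by
  simp [pathTo, h]

theorem pathTo_succ (N : ℕ → Node L) (e : ℕ → Edge L) (n : ℕ) :
    pathTo N e (n + 1) = pathTo N e n ++ [(N n, e n)] := by
  simp [pathTo, List.range_succ]

theorem length_pathTo (N : ℕ → Node L) (e : ℕ → Edge L) (n : ℕ) :
    (pathTo N e n).length = n := by
  simp [pathTo]

/-- The number of subgoals that have been left behind at negation arcs. -/
def leftBehind (N : ℕ → Node L) (e : ℕ → Edge L) : ℕ → ℕ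
  | 0 => 0
  | i + 1 =>
    match e i with
    | .arc => leftBehind N e i + ((N i).goal.length - 1)
    | _ => leftBehind N e i

/-- The number of open subgoals, including those left behind at negation arcs. -/
def height (N : ℕ → Node L) (e : ℕ → Edge L) (i : ℕ) : ℕ :=
  leftBehind N e i + (N i).goal.length

theorem ancestor_of_height_le {U : MguRule L} {P : Program L} {N : ℕ → Node L} {e : ℕ → Edge L}
    (hs : ∀ i, Step U P (N i) (e i) (N (i + 1))) (hd : ∀ i, (N i).depth = i) {i k : ℕ}
    {θ : Subst L} (he : e i = .clause k θ) (hi : ∀ j ≥ i, height N e i ≤ height N e j) :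
    ∀ j > i, ∀ s rest, (N j).goal = s :: rest → i ∈ s.anc := by
  have inv : ∀ j ≥ i + 1, ∃ front back, (N j).goal = front ++ back ∧ (∀ s ∈ front, i ∈ s.anc) ∧
      (leftBehind N e j + back.length < height N e i ∨ back = []) := by
    intro j hj
    induction j, hj using Nat.le_induction with
    | base =>
      have h := hs i
      rw [he] at h
      obtain ⟨A, anc, rest, B, hgoal, hgoal', hB⟩ := h.clauseStep.exists_goal
      refine ⟨_, _, hgoal', ?_, Or.inl ?_⟩
      · intro s hs
        simp [hB s hs, hd]
      · simp only [height, leftBehind, he, hgoal, List.length_map, List.length_cons]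
        omega
    | succ j hj ih =>
      obtain ⟨front, back, hfb, hfront, hback⟩ := ih
      have hne : ∀ s rest, (N j).goal = s :: rest → ∃ front', front = s :: front' ∧
          rest = front' ++ back := by
        intro s rest hgoal
        rcases front with _ | ⟨s', front'⟩
        · exfalso
          rw [List.nil_append] at hfb
          rcases hback with hback | rfl
          · have := hi j (by omega)
            rw [height, height, hfb] at this
            rw [height] at hback
            omega
          · simp [hfb] at hgoal
        · rw [hfb, List.cons_append, List.cons.injEq] at hgoal
          obtain ⟨rfl, rfl⟩ := hgoal
          exact ⟨front', rfl, rfl⟩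
      have h := hs j
      generalize hej : e j = ej at h
      generalize N (j + 1) = M at h ⊢
      cases h with
      | clause k' θ' N' h hprune =>
        obtain ⟨A, anc, rest, B, hgoal, hgoal', hB⟩ := h.exists_goal
        obtain ⟨front', rfl, rfl⟩ := hne _ _ hgoal
        refine ⟨B ++ front'.map (Subgoal.subst θ'), back.map (Subgoal.subst θ'), ?_, ?_, ?_⟩
        · rw [hgoal', List.map_append, List.append_assoc]
        · intro s hs
          rcases List.mem_append.1 hs with hs | hs
          · rw [hB s hs]
            exact Finset.mem_insert_of_mem (hfront ⟨.pos A, anc⟩ List.mem_cons_self)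
          · obtain ⟨t, ht, rfl⟩ := List.mem_map.1 hs
            exact hfront t (List.mem_cons_of_mem _ ht)
        · simpa [leftBehind, hej] using hback
      | arc M N' h =>
        obtain ⟨A, anc, rest, hgoal, -⟩ := h
        obtain ⟨front', rfl, rfl⟩ := hne _ _ hgoal
        refine ⟨_, [], (List.append_nil _).symm, ?_, Or.inr rfl⟩
        intro s hs
        simp only [List.mem_singleton] at hs
        subst hs
        exact hfront ⟨.neg A, anc⟩ List.mem_cons_self
      | naf M N' h hM =>
        obtain ⟨A, anc, rest, hgoal, -⟩ := h
        obtain ⟨front', rfl, rfl⟩ := hne _ _ hgoal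
        refine ⟨front', back, rfl, fun s hs => hfront s (List.mem_cons_of_mem _ hs), ?_⟩
        simpa [leftBehind, hej] using hback
  intro j hj s rest hgoal
  obtain ⟨front, back, hfb, hfront, hback⟩ := inv j hj
  rcases front with _ | ⟨s', front'⟩
  · exfalso
    rw [List.nil_append] at hfb
    rcases hback with hback | rfl
    · have := hi j (by omega)
      rw [height, height, hfb] at this
      rw [height] at hback
      omega
    · simp [hfb] at hgoal
  · rw [hfb, List.cons_append, List.cons.injEq] at hgoal
    exact hgoal.1 ▸ hfront s' List.mem_cons_self

theorem exists_common_ancestor {U : MguRule L} {P : Program L} {N : ℕ → Node L} {e : ℕ → Edge L}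
    (hs : ∀ i, Step U P (N i) (e i) (N (i + 1))) (hd : ∀ i, (N i).depth = i) (n : ℕ) :
    ∃ i > n, (∃ k θ, e i = .clause k θ) ∧
      ∀ j > i, ∀ s rest, (N j).goal = s :: rest → i ∈ s.anc := by
  obtain ⟨i, hin, hi⟩ : ∃ i > n, ∀ j > n, height N e i ≤ height N e j := by
    let i := Function.argminOn (height N e) (Set.Ioi n) ⟨n + 1, Nat.lt_succ_self n⟩
    exact ⟨i, Function.argminOn_mem (height N e) (Set.Ioi n) _, fun j hj =>
      Function.argminOn_le (height N e) (Set.Ioi n) hj⟩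
  have h := hs i
  generalize hei : e i = ei at h
  generalize hM : N (i + 1) = M at h
  cases h with
  | clause k θ N' h hprune =>
    exact ⟨i, hin, ⟨k, θ, hei⟩,
      ancestor_of_height_le hs hd hei fun j hj => hi j (by omega)⟩
  | arc M N' h =>
    obtain ⟨A, anc, rest, hgoal, -⟩ := h
    have hh : height N e (i + 1) = height N e i := by
      simp [height, leftBehind, hei, hM, hgoal]
      omega
    obtain ⟨k, θ, hk⟩ : ∃ k θ, e (i + 1) = .clause k θ := by
      have h := hs (i + 1)
      generalize hej : e (i + 1) = ej at h
      generalize N (i + 1 + 1) = K at h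
      cases h with
      | clause k θ N' h => exact ⟨k, θ, rfl⟩
      | arc M N' h => obtain ⟨A', anc', rest', hgoal', -⟩ := h; simp [hM] at hgoal'
      | naf M N' h => obtain ⟨A', anc', rest', hgoal', -⟩ := h; simp [hM] at hgoal'
    exact ⟨i + 1, by omega, ⟨k, θ, hk⟩,
      ancestor_of_height_le hs hd hk fun j hj => hh ▸ hi j (by omega)⟩
  | naf M N' h hM' =>
    obtain ⟨A, anc, rest, hgoal, -⟩ := h
    have := hi (i + 1) (by omega)
    simp [height, leftBehind, hei, hM, hgoal] at this

theorem ClauseStep.lt_length {U : MguRule L} {P : Program L} {N N' : Node L} {k : ℕ}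
    {θ : Subst L} (h : ClauseStep U P N k θ N') : k < P.length := by
  obtain ⟨A, anc, rest, C, θ, hgoal, hC, huni, hθ⟩ := h
  exact (List.getElem?_eq_some_iff.1 hC).1

theorem Atom.predSym_eq_of_unifies {τ : Subst L} {A B : Atom L} (h : Unifies τ A B) :
    A.predSym = B.predSym := by
  have h : A.subst τ = B.subst τ := h
  rw [← Atom.predSym_subst τ A, h, Atom.predSym_subst]

/-- Atoms resolved with the same clause have the same predicate symbol. -/
theorem ClauseStep.predSym_eq {U : MguRule L} {P : Program L} {N N' M M' : Node L} {k : ℕ}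
    {θ θ' : Subst L} (h : ClauseStep U P N k θ N') (h' : ClauseStep U P M k θ' M')
    {A B : Atom L} {anc anc' : Finset ℕ} {rest rest' : List (Subgoal L)}
    (hA : N.goal = ⟨.pos A, anc⟩ :: rest) (hB : M.goal = ⟨.pos B, anc'⟩ :: rest') :
    A.predSym = B.predSym := by
  obtain ⟨A₁, anc₁, rest₁, C, θ, hgoal, hC, ⟨τ, hτ⟩, hθ⟩ := h
  obtain ⟨B₁, anc₂, rest₂, C', θ', hgoal', hC', ⟨τ', hτ'⟩, hθ'⟩ := h'
  obtain rfl := Option.some.inj (hC.symm.trans hC')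
  rw [hgoal] at hA
  rw [hgoal'] at hB
  simp only [List.cons.injEq, Subgoal.mk.injEq, Literal.pos.injEq] at hA hB
  obtain ⟨⟨rfl, -⟩, -⟩ := hA
  obtain ⟨⟨rfl, -⟩, -⟩ := hB
  have h1 : A₁.predSym = C.head.predSym :=
    (Atom.predSym_eq_of_unifies hτ).trans rfl
  have h2 : B₁.predSym = C.head.predSym :=
    (Atom.predSym_eq_of_unifies hτ').trans rfl
  exact h1.trans h2.symm

theorem exists_isLoop {U : MguRule L} {P : Program L} {N : ℕ → Node L} {e : ℕ → Edge L}
    (hs : ∀ i, Step U P (N i) (e i) (N (i + 1))) (h0 : (N 0).depth = 0) (hwf : (N 0).WF)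
    {F : Set (Σ n, L.Functions n)} (hF : F.Finite) (hP : ∀ C ∈ P, ∀ A ∈ C.atoms, A.Over F)
    (hG : GoalOver F (N 0).goal) (r : ℕ) :
    ∃ n k θ g, e n = .clause k θ ∧ Path.IsLoop r (pathTo N e (n + 1)) g k := by
  have hd : ∀ i, (N i).depth = i := fun i => by
    induction i with
    | zero => exact h0
    | succ i ih => rw [(hs i).depth, ih]
  have hN : ∀ i, (N i).WF := fun i => by
    induction i with
    | zero => exact hwf
    | succ i ih => exact (hs i).wf ih
  have hO : ∀ i, GoalOver F (N i).goal := fun i => by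
    induction i with
    | zero => exact hG
    | succ i ih => exact (hs i).goalOver (hN i) hP ih
  obtain ⟨φ, hφ, hφ'⟩ := Nat.exists_strictMono_subsequence (exists_common_ancestor hs hd)
  choose hclause hanc using hφ'
  choose κ θ hκ using hclause
  have hstep : ∀ n, ClauseStep U P (N (φ n)) (κ n) (θ n) (N (φ n + 1)) := fun n => by
    have := hs (φ n)
    rw [hκ n] at this
    exact this.clauseStep
  have hgoal : ∀ n, ∃ A anc rest, (N (φ n)).goal = ⟨.pos A, anc⟩ :: rest := fun n => by
    obtain ⟨A, anc, rest, B, h, -⟩ := (hstep n).exists_goal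
    exact ⟨A, anc, rest, h⟩
  choose A anc rest hgoal using hgoal
  obtain ⟨g₁, hg₁⟩ := (Set.Finite.partiallyWellOrderedOn (r := (· = ·))
    (Set.finite_Iio P.length)).exists_monotone_subseq fun n => (hstep n).lt_length
  have hpwo := Set.PartiallyWellOrderedOn.partiallyWellOrderedOn_sublistForall₂ (· = ·)
    (Set.Finite.partiallyWellOrderedOn (r := (· = ·)) ((hF.image Sym.fn).insert Sym.X))
  have : IsPreorder (List (Sym L)) (List.SublistForall₂ (· = ·)) := {}
  obtain ⟨g₂, hg₂⟩ := hpwo.exists_monotone_subseq (f := fun n => (A (g₁ n)).argSym) fun n =>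
    Atom.Over.argSym (hO (φ (g₁ n)) ⟨.pos (A (g₁ n)), _⟩
      (by rw [hgoal]; exact List.mem_cons_self))
  let ψ : ℕ → ℕ := fun j => g₁ (g₂ j)
  have hψ : StrictMono ψ := g₁.strictMono.comp g₂.strictMono
  have hκψ : ∀ j, κ (ψ j) = κ (ψ r) := fun j => by
    rcases le_total (g₂ j) (g₂ r) with h | h
    · exact hg₁ _ _ h
    · exact (hg₁ _ _ h).symm
  have hlt : ∀ {j}, j ≤ r → φ (ψ j) < φ (ψ r) + 1 := fun h =>
    Nat.lt_succ_of_le (hφ.monotone (hψ.monotone h))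
  refine ⟨φ (ψ r), κ (ψ r), θ (ψ r), fun j => φ (ψ j), hκ _, ?_, ?_, ?_⟩
  · exact (length_pathTo _ _ _).symm
  · intro j _ hj
    refine ⟨_, _, _, _, A (ψ j), A (ψ (j + 1)), _, _, _, _, pathTo_getElem? _ _ (hlt hj.le),
      hgoal _, pathTo_getElem? _ _ (hlt hj), hgoal _, ?_, ?_, ?_⟩
    · exact hanc _ _ (hφ (hψ j.lt_succ_self)) _ _ (hgoal _)
    · have h1 := hstep (ψ j)
      rw [(hκψ j).trans (hκψ (j + 1)).symm] at h1
      exact h1.predSym_eq (hstep (ψ (j + 1))) (hgoal _) (hgoal _)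
    · have h1 := hstep (ψ j)
      rw [(hκψ j).trans (hκψ (j + 1)).symm] at h1
      rw [Atom.sym_eq, Atom.sym_eq, h1.predSym_eq (hstep (ψ (j + 1))) (hgoal _) (hgoal _)]
      refine List.Sublist.cons_cons _ ?_
      obtain ⟨l, hl, hsub⟩ := List.sublistForall₂_iff.1 (hg₂ j (j + 1) j.le_succ)
      rw [List.forall₂_eq_eq_eq] at hl
      exact hl ▸ hsub
  · intro j _ hj
    refine ⟨N (φ (ψ j)), θ (ψ j), ?_⟩
    rw [pathTo_getElem? _ _ (hlt hj), hκ, hκψ]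

/-! ## The construction comes to an end -/

/-- `D` is the path from the root to the node `N`. -/
inductive Reach (U : MguRule L) (P : Program L) (root : Node L) : Path L → Node L → Prop
  | root : Reach U P root [] root
  | step {D : Path L} {N N' : Node L} {e : Edge L} (h : Reach U P root D N)
      (hs : Step U P N e N') : Reach U P root (D ++ [(N, e)]) N'

namespace Reach

variable {U : MguRule L} {P : Program L} {root : Node L} {D : Path L} {N : Node L}

theorem wf (h : Reach U P root D N) (hroot : root.WF) : N.WF := by
  induction h with
  | root => exact hroot
  | step h hs ih => exact hs.wf ih

theorem inTree (h : Reach U P root D N) : InTree U P root N := by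
  induction h with
  | root => exact .refl
  | step h hs ih => exact ih.tail hs.child

/-- The variables of the terms bound to input variables are input variables ever after. -/
theorem mem_inp (h : Reach U P root D N) {s : ℕ} {M : Node L} {k : ℕ} {θ : Subst L}
    (hs : D[s]? = some (M, .clause k θ)) {x y : ℕ} (hx : x ∈ M.inp)
    (hy : y ∈ (θ x).varFinset) : y ∈ N.inp := by
  induction h with
  | root => simp at hs
  | @step D N N' e h hst ih =>
    rcases lt_trichotomy s D.length with hlt | rfl | hgt
    · rw [List.getElem?_append_left hlt] at hs
      exact hst.inp_subset (ih hs)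
    · simp only [List.getElem?_concat_length, Option.some.injEq, Prod.mk.injEq] at hs
      obtain ⟨rfl, rfl⟩ := hs
      have h := hst.clauseStep
      cases h
      exact Finset.mem_union_right _ (Finset.mem_biUnion.2 ⟨x, hx, hy⟩)
    · rw [List.getElem?_eq_none (by simp; omega)] at hs
      simp at hs

/-- Loops that end in a subsidiary tree do not have the term-size decrease property. -/
theorem not_termSizeDecrease (h : Reach U P root D N) (hroot : root.WF) (hsub : N.sub = true)
    {r k : ℕ} (hr : 2 ≤ r) {e : Edge L} {g : ℕ → ℕ} (hg : Path.IsLoop r (D ++ [(N, e)]) g k) :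
    ¬ Path.TermSizeDecrease r (D ++ [(N, e)]) g := by
  intro hdec
  obtain ⟨s, -, hs, M, k', θ, hM, x, hx, -, -, -, -, y, hy, N', e', l, anc, rest, hN', hgoal,
    hyl⟩ := hdec (r - 1) (by omega) (by omega)
  rw [Nat.sub_add_cancel (by omega)] at hs hN'
  have hlast := hg.last
  simp only [List.length_append, List.length_singleton, Nat.add_right_cancel_iff] at hlast
  rw [hlast] at hs hN'
  rw [List.getElem?_append_left hs] at hM
  simp only [List.getElem?_concat_length, Option.some.injEq, Prod.mk.injEq] at hN'
  obtain ⟨rfl, rfl⟩ := hN'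
  refine (h.wf hroot).sub hsub y (h.mem_inp hM hx hy) ⟨⟨l, anc⟩, ?_, hyl⟩
  rw [hgoal]
  exact List.mem_cons_self

end Reach

/-- `BuildChild U P r t s`: in the construction with repetition number `r`, the node `t` may be
visited as a child of the node `s`. -/
def BuildChild (U : MguRule L) (P : Program L) (r : ℕ) (t s : Path L × Node L) : Prop :=
  ∃ e, Step U P s.2 e t.2 ∧ t.1 = s.1 ++ [(s.2, e)] ∧
    ∀ k θ, e = .clause k θ → ¬ ∃ g, Path.IsLoop r t.1 g k

theorem acc_buildChild {U : MguRule L} {P : Program L} {root : Node L}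
    (h0 : root.depth = 0) (hwf : root.WF) {F : Set (Σ n, L.Functions n)} (hF : F.Finite)
    (hP : ∀ C ∈ P, ∀ A ∈ C.atoms, A.Over F) (hG : GoalOver F root.goal) (r : ℕ) :
    Acc (BuildChild U P r) ([], root) := by
  by_contra hacc
  obtain ⟨f, hf0, hf⟩ := not_acc_iff_exists_descending_chain.1 hacc
  choose e he hpath hloop using hf
  have hN0 : (f 0).2 = root := by rw [hf0]
  have hD : ∀ n, (f n).1 = pathTo (fun i => (f i).2) e n := fun n => by
    induction n with
    | zero => simp [hf0, pathTo]
    | succ n ih => rw [hpath n, ih, pathTo_succ]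
  obtain ⟨n, k, θ, g, hk, hg⟩ := exists_isLoop (N := fun i => (f i).2) he (by simp only [hN0, h0])
    (by simpa only [hN0] using hwf) hF hP (by simpa only [hN0] using hG) r
  exact hloop n k θ hk ⟨g, by rwa [hD]⟩

/-- In a subsidiary tree, the outcome tells whether the node succeeds or fails finitely. -/
def Outcome.Exact (U : MguRule L) (P : Program L) (N : Node L) (o : Outcome) : Prop :=
  N.sub = true → (∀ b, o = .done true b → Succeeds U P N) ∧
    (∀ b, o = .done false b → FinFails U P N)

theorem ClauseStep.sub_eq {U : MguRule L} {P : Program L} {N N' : Node L} {k : ℕ} {θ : Subst L}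
    (h : ClauseStep U P N k θ N') : N'.sub = N.sub := by
  cases h
  rfl

theorem Build.exact {U : MguRule L} {P : Program L} {root : Node L} (hwf : root.WF) {r : ℕ}
    (hr : 2 ≤ r) {D : Path L} {N : Node L} {b : Bool} {o : Outcome} (h : Build U P r D N b o) :
    Reach U P root D N → o.Exact U P N := by
  induction h using Build.rec (motive_2 := fun D N k b o _ => Reach U P root D N →
    (∃ A anc rest, N.goal = ⟨.pos A, anc⟩ :: rest) →
    (N.sub = true → ∀ j < k, ∀ θ N', ClauseStep U P N j θ N' → FinFails U P N') →
    o.Exact U P N) with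
  | empty D N b h => exact fun _ _ => ⟨fun _ _ => .empty N h, by simp⟩
  | pos D N b o A anc rest hgoal h ih =>
    exact fun hreach => ih hreach ⟨A, anc, rest, hgoal⟩ fun _ j hj => absurd hj (Nat.not_lt_zero j)
  | neg_stopped => exact fun _ _ => ⟨by simp, by simp⟩
  | neg_fail D N M N' b b' h hM ih =>
    intro hreach hsub
    have hsubM : M.sub = true := by cases h; rfl
    exact ⟨by simp, fun _ _ => .neg N M N' h ((ih (hreach.step (.arc M N' h)) hsubM).1 b' rfl)⟩
  | neg_succ D N M N' b b' o h hM h' ihM ih =>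
    intro hreach hsub
    have hsubM : M.sub = true := by cases h; rfl
    have hsub' : N'.sub = true := by cases h; exact hsub
    have hfail := (ihM (hreach.step (.arc M N' h)) hsubM).2 b' rfl
    have hex := ih (hreach.step (.naf M N' h hfail)) hsub'
    exact ⟨fun b h' => .naf N M N' h hfail (hex.1 b h'),
      fun b h' => .naf N M N' h hfail (hex.2 b h')⟩
  | last D N k b hlen =>
    rename_i hgoal hk
    obtain ⟨A, anc, rest, hgoal⟩ := hgoal
    intro hsub
    exact ⟨by simp, fun _ _ => .clause N A anc rest hgoal fun j θ N' hs =>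
      hk hsub j (hs.lt_length.trans_le hlen) θ N' hs⟩
  | none D N k b o hlen hno h' ih =>
    rename_i hreach hgoal hk
    refine ih hreach hgoal fun hsub j hj θ N' hs => ?_
    rcases Nat.lt_succ_iff_lt_or_eq.1 hj with hj | rfl
    · exact hk hsub j hj θ N' hs
    · exact absurd hs (hno θ N')
  | cut => exact fun _ => ⟨by simp, by simp⟩
  | skip D N k b o θ N' h hg hdec h' ih =>
    rename_i hreach hgoal _
    obtain ⟨g, hg⟩ := hg
    exact ih hreach hgoal fun hsub =>
      absurd (hdec g hg) (hreach.not_termSizeDecrease hwf hsub hr hg)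
  | child_stopped => exact fun _ => ⟨by simp, by simp⟩
  | first_success D N k b b' θ N' hs hg hN' hsub ih =>
    rename_i hreach _ hk
    intro _
    have hst : Step U P N (.clause k θ) N' := .clause k θ N' hs
      fun hsub j hj θ' N'' hs' => (hk hsub j hj θ' N'' hs').not_succeeds
    exact ⟨fun _ _ => .clause N k θ N' hs ((ih (hreach.step hst) (hs.sub_eq.trans hsub)).1 b' rfl),
      by simp⟩
  | next D N k b s b' o θ N' hs hg hN' hsub h' ih ih' =>
    rename_i hreach hgoal hk
    intro hsubN
    have hst : Step U P N (.clause k θ) N' := .clause k θ N' hs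
      fun hsub j hj θ' N'' hs' => (hk hsub j hj θ' N'' hs').not_succeeds
    have hs0 : s = false := by
      cases s
      · rfl
      · exact absurd ⟨hsubN, rfl⟩ hsub
    subst hs0
    have hfail := (ih (hreach.step hst) (hs.sub_eq.trans hsubN)).2 b' rfl
    have hex := ih' hreach hgoal (fun hsub j hj θ' N'' hs' => by
      rcases Nat.lt_succ_iff_lt_or_eq.1 hj with hj | rfl
      · exact hk hsub j hj θ' N'' hs'
      · obtain ⟨rfl, rfl⟩ := hs.unique hs'
        exact hfail) hsubN
    cases o with
    | stopped => exact ⟨by simp [Outcome.orSuccess], by simp [Outcome.orSuccess]⟩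
    | done s b => simpa [Outcome.orSuccess] using hex

theorem exists_buildFrom {U : MguRule L} {P : Program L} {root : Node L} (hwf : root.WF) {r : ℕ}
    (hr : 2 ≤ r) {D : Path L} {N : Node L} (hreach : Reach U P root D N)
    (ih : ∀ k θ N', Step U P N (.clause k θ) N' →
      (¬ ∃ g, Path.IsLoop r (D ++ [(N, .clause k θ)]) g k) →
      ∀ b, ∃ o, Build U P r (D ++ [(N, .clause k θ)]) N' b o)
    (m k : ℕ) (hm : P.length ≤ k + m)
    (hk : N.sub = true → ∀ j < k, ∀ θ N', ClauseStep U P N j θ N' → FinFails U P N') (b : Bool) :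
    ∃ o, BuildFrom U P r D N k b o := by
  induction m generalizing k b with
  | zero => exact ⟨_, .last D N k b hm⟩
  | succ m ihm =>
    have ihm := ihm (k + 1) (by omega)
    by_cases hlen : P.length ≤ k
    · exact ⟨_, .last D N k b hlen⟩
    rw [not_le] at hlen
    by_cases hstep : ∃ θ N', ClauseStep U P N k θ N'
    swap
    · have hstep : ∀ θ N', ¬ ClauseStep U P N k θ N' := fun θ N' h => hstep ⟨θ, N', h⟩
      obtain ⟨o, ho⟩ := ihm (fun hsub j hj θ N' hs => by
        rcases Nat.lt_succ_iff_lt_or_eq.1 hj with hj | rfl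
        · exact hk hsub j hj θ N' hs
        · exact absurd hs (hstep θ N')) b
      exact ⟨o, .none D N k b o hlen hstep ho⟩
    obtain ⟨θ, N', hs⟩ := hstep
    by_cases hloop : ∃ g, Path.IsLoop r (D ++ [(N, .clause k θ)]) g k
    · by_cases hdec : ∀ g, Path.IsLoop r (D ++ [(N, .clause k θ)]) g k →
          Path.TermSizeDecrease r (D ++ [(N, .clause k θ)]) g
      · obtain ⟨g, hg⟩ := hloop
        obtain ⟨o, ho⟩ := ihm (fun hsub =>
          absurd (hdec g hg) (hreach.not_termSizeDecrease hwf hsub hr hg)) true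
        exact ⟨o, .skip D N k b o θ N' hs ⟨g, hg⟩ hdec ho⟩
      · push Not at hdec
        obtain ⟨g, hg, hdec⟩ := hdec
        exact ⟨_, .cut D N k b θ N' hs g hg hdec⟩
    · have hst : Step U P N (.clause k θ) N' := .clause k θ N' hs
        fun hsub j hj θ' N'' hs' => (hk hsub j hj θ' N'' hs').not_succeeds
      obtain ⟨o, ho⟩ := ih k θ N' hst hloop b
      cases o with
      | stopped => exact ⟨_, .child_stopped D N k b θ N' hs hloop ho⟩
      | done s b' =>
        by_cases hsub : N.sub = true ∧ s = true
        · obtain ⟨hsub, rfl⟩ := hsub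
          exact ⟨_, .first_success D N k b b' θ N' hs hloop ho hsub⟩
        · obtain ⟨o, ho'⟩ := ihm (fun h j hj θ' N'' hs' => by
            rcases Nat.lt_succ_iff_lt_or_eq.1 hj with hj | rfl
            · exact hk h j hj θ' N'' hs'
            · obtain ⟨rfl, rfl⟩ := hs.unique hs'
              have hex := ho.exact hwf hr (hreach.step hst) (hs.sub_eq.trans h)
              cases s
              · exact hex.2 b' rfl
              · exact absurd ⟨h, rfl⟩ hsub) b'
          exact ⟨_, .next D N k b s b' o θ N' hs hloop ho hsub ho'⟩

theorem exists_build {U : MguRule L} {P : Program L} {root : Node L} (hwf : root.WF)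
    (hground : ∀ N, InTree U P root N → ∀ A anc rest, N.goal = ⟨.neg A, anc⟩ :: rest →
      A.vars = ∅) {r : ℕ} (hr : 2 ≤ r) {t : Path L × Node L} (hacc : Acc (BuildChild U P r) t)
    (hreach : Reach U P root t.1 t.2) (b : Bool) : ∃ o, Build U P r t.1 t.2 b o := by
  induction hacc generalizing b with
  | intro t _ ih =>
  obtain ⟨D, N⟩ := t
  dsimp only at hreach ⊢
  have ih : ∀ e N', Step U P N e N' →
      (∀ k θ, e = .clause k θ → ¬ ∃ g, Path.IsLoop r (D ++ [(N, e)]) g k) →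
      ∀ b, ∃ o, Build U P r (D ++ [(N, e)]) N' b o :=
    fun e N' hs hl b => ih (D ++ [(N, e)], N') ⟨e, hs, rfl, hl⟩ (hreach.step hs) b
  rcases hgoal : N.goal with _ | ⟨⟨A | A, anc⟩, rest⟩
  · exact ⟨_, .empty D N b hgoal⟩
  · obtain ⟨o, ho⟩ := exists_buildFrom hwf hr hreach
      (fun k θ N' hs hl b => ih _ N' hs (fun k' θ' h => by
        obtain ⟨rfl, rfl⟩ := Edge.clause.inj h
        exact hl) b)
      P.length 0 (by omega) (fun _ j hj => absurd hj (Nat.not_lt_zero j)) b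
    exact ⟨o, .pos D N b o A anc rest hgoal ho⟩
  · have hn := NegStep.intro A anc rest hgoal (hground N hreach.inTree A anc rest hgoal)
    obtain ⟨o, ho⟩ := ih .arc _ (.arc _ _ hn) (by simp) b
    cases o with
    | stopped => exact ⟨_, .neg_stopped D N _ _ b hn ho⟩
    | done s b' =>
      cases s with
      | true => exact ⟨_, .neg_fail D N _ _ b b' hn ho⟩
      | false =>
        have hM := (ho.exact hwf hr (hreach.step (.arc _ _ hn)) rfl).2 b' rfl
        obtain ⟨o, ho'⟩ := ih .naf _ (.naf _ _ hn hM) (by simp) b'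
        exact ⟨o, .neg_succ D N _ _ b b' o hn ho ho'⟩

/-! ## The construction below an infinite derivation -/

theorem reach_pathTo {U : MguRule L} {P : Program L} {M : ℕ → Node L} {e : ℕ → Edge L}
    (hs : ∀ i, Step U P (M i) (e i) (M (i + 1))) (i : ℕ) :
    Reach U P (M 0) (pathTo M e i) (M i) := by
  induction i with
  | zero => exact .root
  | succ i ih => rw [pathTo_succ]; exact ih.step (hs i)

theorem Build.eq_stopped {U : MguRule L} {P : Program L} {M : ℕ → Node L} {e : ℕ → Edge L}
    (hs : ∀ i, Step U P (M i) (e i) (M (i + 1))) (hwf : (M 0).WF) {r : ℕ} (hr : 2 ≤ r)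
    (hdec : ∀ i k g, Path.IsLoop r (pathTo M e i) g k → ¬ Path.TermSizeDecrease r (pathTo M e i) g)
    {D : Path L} {N : Node L} {b : Bool} {o : Outcome} (h : Build U P r D N b o) :
    ∀ i, D = pathTo M e i → N = M i → o = .stopped := by
  induction h using Build.rec (motive_2 := fun D N j b o _ => ∀ i, D = pathTo M e i → N = M i →
    ∀ k θ, e i = .clause k θ → j ≤ k → o = .stopped) with
  | empty D N b h =>
    rintro i - rfl
    have hst := hs i
    generalize e i = ei at hst
    generalize M (i + 1) = M' at hst
    cases hst with
    | clause k θ N' h' => cases h'; simp_all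
    | arc K N' h' => cases h'; simp_all
    | naf K N' h' => cases h'; simp_all
  | pos D N b o A anc rest hgoal h ih =>
    rintro i rfl rfl
    have hst := hs i
    generalize hei : e i = ei at hst
    generalize M (i + 1) = M' at hst
    cases hst with
    | clause k θ N' h' => exact ih i rfl rfl k θ hei (Nat.zero_le k)
    | arc K N' h' => cases h'; simp_all
    | naf K N' h' => cases h'; simp_all
  | neg_stopped => exact fun _ _ _ => rfl
  | neg_fail D N K N' b b' h hK ih =>
    rintro i rfl rfl
    have hst := hs i
    generalize hei : e i = ei at hst
    generalize hMi : M (i + 1) = M' at hst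
    cases hst with
    | clause k θ N' h' => exact (h'.not_negStep h).elim
    | arc K' N' h' =>
      obtain ⟨rfl, rfl⟩ := h.unique h'
      have := ih (i + 1) (by rw [pathTo_succ, hei]) hMi.symm
      simp at this
    | naf K' N' h' hfail =>
      obtain ⟨rfl, rfl⟩ := h.unique h'
      have hsub : K.sub = true := by cases h; rfl
      exact (hfail.not_succeeds
        ((hK.exact hwf hr ((reach_pathTo hs i).step (.arc _ _ h)) hsub).1 b' rfl)).elim
  | neg_succ D N K N' b b' o h hK h' ihK ih =>
    rintro i rfl rfl
    have hst := hs i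
    generalize hei : e i = ei at hst
    generalize hMi : M (i + 1) = M' at hst
    cases hst with
    | clause k θ N' h' => exact (h'.not_negStep h).elim
    | arc K' N' h' =>
      obtain ⟨rfl, rfl⟩ := h.unique h'
      have := ihK (i + 1) (by rw [pathTo_succ, hei]) hMi.symm
      simp at this
    | naf K' N' h' hfail =>
      obtain ⟨rfl, rfl⟩ := h.unique h'
      exact ih (i + 1) (by rw [pathTo_succ, hei]) hMi.symm
  | last D N j b hlen =>
    rename_i i hD hN k θ he hj
    subst hD hN
    have hk := (he ▸ hs i).clauseStep.lt_length
    omega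
  | none D N j b o hlen hno h' ih =>
    rename_i i hD hN k θ he hj
    subst hD hN
    rcases hj.lt_or_eq with hj | rfl
    · exact ih i rfl rfl k θ he hj
    · exact absurd (he ▸ hs i).clauseStep (hno _ _)
  | cut => rfl
  | skip D N j b o θ' N' h hg hdec' h' ih =>
    rename_i i hD hN k θ he hj
    subst hD hN
    rcases hj.lt_or_eq with hj | rfl
    · exact ih i rfl rfl k θ he hj
    · obtain ⟨g, hg⟩ := hg
      obtain ⟨rfl, -⟩ := (he ▸ hs i).clauseStep.unique h
      have hd := hdec' g hg
      rw [← he, ← pathTo_succ] at hg hd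
      exact absurd hd (hdec _ _ _ hg)
  | child_stopped => rfl
  | first_success D N j b b' θ' N' h hg hN' hsub ih =>
    rename_i i hD hN k θ he hj
    subst hD hN
    have hst := hs i
    rw [he] at hst
    rcases hj.lt_or_eq with hj | rfl
    · cases hst with
      | clause _ _ _ _ hprune =>
        have hst' : Step U P (M i) (.clause j θ') N' := .clause j θ' N' h
          fun hsub j' hj' => hprune hsub j' (hj'.trans hj)
        exact absurd ((hN'.exact hwf hr ((reach_pathTo hs i).step hst')
          (h.sub_eq.trans hsub)).1 b' rfl) (hprune hsub j hj θ' N' h)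
    · obtain ⟨rfl, hN⟩ := hst.clauseStep.unique h
      have := ih (i + 1) (by rw [pathTo_succ, he]) hN.symm
      simp at this
  | next D N j b s b' o θ' N' h hg hN' hsub h' ih ih' =>
    rename_i i hD hN k θ he hj
    subst hD hN
    have hst := hs i
    rw [he] at hst
    rcases hj.lt_or_eq with hj | rfl
    · rw [ih' i rfl rfl k θ he hj]
      rfl
    · obtain ⟨rfl, hN⟩ := hst.clauseStep.unique h
      have := ih (i + 1) (by rw [pathTo_succ, he]) hN.symm
      simp at this

/-! ## Lifting infinite derivations to the moded tree -/

/-- The edge `e` from `M` replaces an input variable by a term with a function symbol. -/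
def BindsInput (M : Node L) (e : Edge L) : Prop :=
  ∃ k θ, e = .clause k θ ∧ ∃ x ∈ M.inp, ∃ (n : ℕ) (f : L.Functions n) (ts : Fin n → Tm L),
    θ x = .func f ts

open Classical in
/-- The input variables that occur in the goal. -/
noncomputable def Node.activeInp (M : Node L) : Finset ℕ := M.inp.filter fun x => OccursIn x M.goal

theorem Node.mem_activeInp {M : Node L} {x : ℕ} :
    x ∈ M.activeInp ↔ x ∈ M.inp ∧ OccursIn x M.goal := by
  simp [activeInp]

/-- The node `N` of a tree for an instance of a moded query lifts to the node `M` of the moded tree,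
where the active input variables of `M` stand for ground terms of total size at most `n`. -/
structure Lifts (n : ℕ) (N M : Node L) : Prop where
  wf_left : N.WF
  wf_right : M.WF
  sub_eq : M.sub = N.sub
  variant : N.sub = true → Variant N M
  inst : ∃ σ, InstBy σ N.goal M.goal ∧ (∀ x ∈ M.activeInp, (σ x).varFinset = ∅) ∧
    ∑ x ∈ M.activeInp, (σ x).size ≤ n

theorem Lifts.clauseStep {U U' : MguRule L} {P : Program L} {N N' M : Node L} {n k : ℕ}
    {θ : Subst L} (h : Lifts n N M) (hs : ClauseStep U P N k θ N') :
    ∃ θ' M' n', ClauseStep U' P M k θ' M' ∧ Lifts n' N' M' ∧ n' ≤ n ∧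
      (BindsInput M (.clause k θ') → n' < n) := by
  obtain ⟨σ, hσ, hground, hn⟩ := h.inst
  obtain ⟨θ', M', δ, hs', hδ, heq⟩ := hs.lift (U' := U') h.wf_left h.wf_right hσ
  have hact : ∀ y ∈ M'.activeInp, ∃ x ∈ M.activeInp, y ∈ (θ' x).varFinset := by
    intro y hy
    rw [Node.mem_activeInp] at hy
    obtain ⟨x, hx, hxo, hxy⟩ := hs'.exists_inp h.wf_right hy.1 hy.2
    exact ⟨x, Node.mem_activeInp.2 ⟨hx, hxo⟩, hxy⟩
  have hσδ : ∀ x ∈ M.activeInp, (θ' x).subst δ = σ x := by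
    intro x hx
    rw [← heq x (h.wf_right.inp (Node.mem_activeInp.1 hx).1), Tm.subst_of_ground (hground x hx)]
  have hle : ∀ x ∈ M.activeInp, ∑ y ∈ (θ' x).varFinset, (δ y).size ≤ (σ x).size := by
    intro x hx
    rw [← hσδ x hx]
    exact Tm.sum_size_le δ (θ' x)
  have hsum : ∑ y ∈ M'.activeInp, (δ y).size ≤
      ∑ x ∈ M.activeInp, ∑ y ∈ (θ' x).varFinset, (δ y).size :=
    sum_le_sum_sum _ _ _ fun y hy => Finset.mem_biUnion.2 (hact y hy)
  refine ⟨θ', M', ∑ y ∈ M'.activeInp, (δ y).size, hs', ⟨hs.wf h.wf_left, hs'.wf h.wf_right, ?_, ?_,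
    δ, hδ, ?_, le_rfl⟩, ?_, ?_⟩
  · rw [hs.sub_eq, hs'.sub_eq, h.sub_eq]
  · intro hsub
    rw [hs.sub_eq] at hsub
    obtain ⟨θ'', M'', hs'', hv⟩ :=
      (h.variant hsub).clauseStep (U' := U') h.wf_left h.wf_right hs
    obtain ⟨-, rfl⟩ := hs'.unique hs''
    exact hv
  · intro y hy
    obtain ⟨x, hx, hxy⟩ := hact y hy
    have := hground x hx
    rw [← hσδ x hx] at this
    refine Finset.eq_empty_of_forall_notMem fun z hz => ?_
    have hz' := Tm.mem_varFinset_subst.2 ⟨y, hxy, hz⟩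
    simp [this] at hz'
  · exact (hsum.trans (Finset.sum_le_sum hle)).trans hn
  · rintro ⟨k', θ'', he, x, hx, m, f, ts, hf⟩
    obtain ⟨rfl, rfl⟩ := Edge.clause.inj he
    have hxa : x ∈ M.activeInp := Node.mem_activeInp.2
      ⟨hx, hs'.occursIn_of_bound h.wf_right hx (by simp [hf])⟩
    refine (hsum.trans_lt (Finset.sum_lt_sum hle ⟨x, hxa, ?_⟩)).trans_le hn
    rw [← hσδ x hxa, hf]
    exact Tm.sum_size_lt δ f ts

theorem Lifts.step {U U' : MguRule L} {P : Program L} {N N' M : Node L} {n : ℕ} {e : Edge L}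
    (h : Lifts n N M) (hs : Step U P N e N')
    (hM : ∀ A anc rest, M.goal = ⟨.neg A, anc⟩ :: rest → A.vars = ∅) :
    ∃ e' M' n', Step U' P M e' M' ∧ Lifts n' N' M' ∧ n' ≤ n ∧ (BindsInput M e' → n' < n) := by
  cases hs with
  | clause k θ N' hs hprune =>
    obtain ⟨θ', M', n', hs', hl, hn⟩ := h.clauseStep (U' := U') hs
    refine ⟨_, M', n', .clause k θ' M' hs' fun hsub j hj τ M'' hs'' hsucc => ?_, hl, hn⟩
    rw [h.sub_eq] at hsub
    obtain ⟨τ', N'', hsN, hv⟩ :=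
      (h.variant hsub).symm.clauseStep (U' := U) h.wf_right h.wf_left hs''
    exact hprune hsub j hj τ' N'' hsN
      (hsucc.variant hv (hs''.wf h.wf_right) (hsN.wf h.wf_left))
  | arc K N'' hs =>
    obtain ⟨σ, hσ, hground, hn⟩ := h.inst
    obtain ⟨K', M', hs', hK, -⟩ := hs.lift hσ hM
    have hsubK : N'.sub = true := by cases hs; rfl
    have hsubK' : K'.sub = true := by cases hs'; rfl
    have hact : ∀ x, x ∉ K'.activeInp := fun x hx => by
      rw [Node.mem_activeInp] at hx
      exact (hs'.wf_left h.wf_right).sub hsubK' x hx.1 hx.2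
    refine ⟨_, K', n, .arc K' M' hs', ⟨hs.wf_left h.wf_left, hs'.wf_left h.wf_right,
      hsubK'.trans hsubK.symm, fun _ => .of_lit_eq hK, fun x => .var x, by simp [InstBy, hK],
      fun x hx => absurd hx (hact x), ?_⟩, le_rfl, ?_⟩
    · rw [Finset.eq_empty_of_forall_notMem hact]
      simp
    · rintro ⟨k, θ, he, -⟩
      simp at he
  | naf K N' hs hfail =>
    obtain ⟨σ, hσ, hground, hn⟩ := h.inst
    obtain ⟨K', M', hs', hK, hσ'⟩ := hs.lift hσ hM
    have hact : M'.activeInp ⊆ M.activeInp := by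
      intro x hx
      rw [Node.mem_activeInp] at hx ⊢
      obtain ⟨A, anc, rest, hgoal, -⟩ := hs'
      obtain ⟨hx, s, hs, hxs⟩ := hx
      exact ⟨hx, s, by rw [hgoal]; exact List.mem_cons_of_mem _ hs, hxs⟩
    refine ⟨_, M', n, .naf K' M' hs' (hfail.variant (.of_lit_eq hK) (hs.wf_left h.wf_left)
      (hs'.wf_left h.wf_right)), ⟨hs.wf_right h.wf_left, hs'.wf_right h.wf_right, ?_, ?_, σ, hσ',
      fun x hx => hground x (hact hx), (Finset.sum_le_sum_of_subset hact).trans hn⟩, le_rfl, ?_⟩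
    · have h1 : M'.sub = M.sub := by cases hs'; rfl
      have h2 : N'.sub = N.sub := by cases hs; rfl
      rw [h1, h2, h.sub_eq]
    · intro hsub
      have h2 : N'.sub = N.sub := by cases hs; rfl
      obtain ⟨K'', M'', hs'', -, hv⟩ := (h.variant (h2 ▸ hsub)).negStep hs
      obtain ⟨-, rfl⟩ := hs'.unique hs''
      exact hv
    · rintro ⟨k, θ, he, -⟩
      simp at he

theorem exists_lift {U U' : MguRule L} {P : Program L} {N : ℕ → Node L} {n : ℕ} {root : Node L}
    (hN : ∀ i, Child U P (N i) (N (i + 1))) (hroot : Lifts n (N 0) root)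
    (hground : ∀ M, InTree U' P root M → ∀ A anc rest, M.goal = ⟨.neg A, anc⟩ :: rest →
      A.vars = ∅) :
    ∃ (M : ℕ → Node L) (e : ℕ → Edge L) (w : ℕ → ℕ), M 0 = root ∧ w 0 = n ∧
      ∀ i, Step U' P (M i) (e i) (M (i + 1)) ∧ w (i + 1) ≤ w i ∧
        (BindsInput (M i) (e i) → w (i + 1) < w i) := by
  let S : ℕ → Type _ := fun i =>
    {t : Node L × ℕ // Lifts t.2 (N i) t.1 ∧ InTree U' P root t.1}
  have hstep : ∀ i (t : S i), ∃ (t' : S (i + 1)) (e : Edge L), Step U' P t.1.1 e t'.1.1 ∧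
      t'.1.2 ≤ t.1.2 ∧ (BindsInput t.1.1 e → t'.1.2 < t.1.2) := by
    rintro i ⟨⟨M, w⟩, hl, ht⟩
    obtain ⟨e, hs⟩ := (hN i).exists_step
    obtain ⟨e', M', w', hs', hl', hw⟩ := hl.step (U' := U') hs (hground M ht)
    exact ⟨⟨(M', w'), hl', ht.tail hs'.child⟩, e', hs', hw⟩
  choose next edge hnext using hstep
  let f : ∀ i, S i := fun i => Nat.rec ⟨(root, n), hroot, .refl⟩ (fun i t => next i t) i
  exact ⟨fun i => (f i).1.1, fun i => edge i (f i), fun i => (f i).1.2, rfl, rfl,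
    fun i => hnext i (f i)⟩

theorem not_termSizeDecrease_of_weight {M : ℕ → Node L} {e : ℕ → Edge L} {w : ℕ → ℕ}
    (hw : ∀ i, w (i + 1) ≤ w i) (hb : ∀ i, BindsInput (M i) (e i) → w (i + 1) < w i) {r : ℕ}
    (hr : w 0 + 2 ≤ r) (n k : ℕ) (g : ℕ → ℕ)
    (_ : Path.IsLoop r (pathTo M e n) g k) :
    ¬ Path.TermSizeDecrease r (pathTo M e n) g := by
  intro hdec
  have hanti : Antitone w := antitone_nat_of_succ_le hw
  have key : ∀ i, i < r → w (g (i + 1)) + i ≤ w 0 := by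
    intro i
    induction i with
    | zero => exact fun _ => hanti (Nat.zero_le _)
    | succ i ih =>
      intro hi
      obtain ⟨s, hs, hs', N, k', θ, hN, x, hx, m, f, ts, hf, -⟩ := hdec (i + 1) (by omega) hi
      have hsn : s < n := by
        have := (List.getElem?_eq_some_iff.1 hN).1
        rwa [length_pathTo] at this
      rw [pathTo_getElem? _ _ hsn, Option.some.injEq, Prod.mk.injEq] at hN
      obtain ⟨rfl, he⟩ := hN
      have h1 := hb s ⟨k', θ, he, x, hx, m, f, ts, hf⟩
      have h2 := hanti hs
      have h3 := hanti (Nat.succ_le_of_lt hs')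
      have h4 := ih (by omega)
      simp only [Nat.succ_eq_add_one] at h3
      omega
  have := key (r - 1) (by omega)
  omega

/-! ## Queries -/

namespace Query

theorem inpVar_injective (Q : Query L) : Function.Injective Q.inpVar := by
  intro i j h
  simp only [inpVar] at h
  omega

theorem notMem_vars_inpVar (Q : Query L) (i : Fin Q.arity) : Q.inpVar i ∉ Q.vars := by
  intro h
  have := Finset.le_sup (f := id) h
  simp only [id, inpVar] at this
  omega

end Query

theorem HU.varFinset_eq_empty {P : Program L} {c : L.Constants} {t : Tm L} (h : HU P c t) :
    t.varFinset = ∅ := by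
  induction h with
  | func f ts hf hts ih => 
    simp only [FirstOrder.Language.Term.varFinset, ih]
    exact Finset.eq_empty_of_forall_notMem (by simp)
  | extra ts hP => simp [FirstOrder.Language.Term.varFinset]

theorem modedRoot_wf (Q : Query L) : Q.modedRoot.WF := by
  refine rootNode_wf fun x hx => ?_
  obtain ⟨i, hi, rfl⟩ := Finset.mem_image.1 hx
  refine Atom.mem_vars.2 ⟨i, ?_⟩
  simp only [Finset.mem_filter, Option.isNone_iff_eq_none] at hi
  simp [Query.inst, hi.2, FirstOrder.Language.Term.varFinset]

theorem lifts_modedRoot {P : Program L} {c : L.Constants} {Q : Query L} {t : Fin Q.arity → Tm L}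
    (ht : ∀ i, Q.args i = none → HU P c (t i)) :
    ∃ n, Lifts n (rootNode (Q.inst t) ∅) Q.modedRoot := by
  let σ : Subst L := fun x => if h : ∃ i, Q.inpVar i = x then t h.choose else .var x
  have hσ : ∀ i, σ (Q.inpVar i) = t i := by
    intro i
    have h : ∃ j, Q.inpVar j = Q.inpVar i := ⟨i, rfl⟩
    simp only [σ, dif_pos h]
    exact congrArg t (Q.inpVar_injective h.choose_spec)
  refine ⟨_, rootNode_wf (Finset.empty_subset _), modedRoot_wf Q, rfl, by simp [rootNode], σ, ?_,
    ?_, le_rfl⟩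
  · simp only [InstBy, rootNode, Query.modedRoot, List.map_cons, List.map_nil, Literal.subst,
      List.cons.injEq, Literal.pos.injEq, and_true]
    simp only [Query.inst, Atom.subst, Atom.mk.injEq, heq_eq_eq, true_and]
    funext i
    rcases hi : Q.args i with _ | s
    · exact (hσ i).symm
    · simp only [Option.getD_some]
      conv_lhs => rw [← Tm.subst_var s]
      refine Tm.subst_congr fun x hx => ?_
      have hxQ : x ∈ Q.vars := by
        simp only [Query.vars, Finset.mem_biUnion, Finset.mem_univ, true_and]
        exact ⟨i, by simpa [hi] using hx⟩
      have hno : ¬ ∃ i, Q.inpVar i = x := by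
        rintro ⟨j, rfl⟩
        exact Q.notMem_vars_inpVar j hxQ
      simp only [σ, dif_neg hno]
  · intro x hx
    obtain ⟨i, hi, rfl⟩ := Finset.mem_image.1 (Node.mem_activeInp.1 hx).1
    simp only [Finset.mem_filter, Option.isNone_iff_eq_none] at hi
    rw [hσ]
    exact (ht i hi.2).varFinset_eq_empty

theorem exists_build_modedRoot {U : MguRule L} {P : Program L} {Q : Query L}
    (hU : NonFloundering U P Q) {r : ℕ} (hr : 2 ≤ r) :
    ∃ o, Build U P r [] Q.modedRoot false o := by
  let l : List (Atom L) := (Q.inst fun i => .var (Q.inpVar i)) :: P.flatMap Clause.atoms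
  have hacc := acc_buildChild (U := U) (P := P) rfl (modedRoot_wf Q) (finite_fnSyms l)
    (fun C hC A hA => over_fnSyms (List.mem_cons_of_mem _ (List.mem_flatMap.2 ⟨C, hC, hA⟩)))
    (fun s hs => by
      simp only [Query.modedRoot, rootNode, List.mem_singleton] at hs
      subst hs
      exact over_fnSyms List.mem_cons_self) r
  exact exists_build (modedRoot_wf Q) hU hr hacc .root false

end TermPred

theorem mainTheorem9 {L : FirstOrder.Language} (P : TermPred.Program L) (c : L.Constants)
    (Q : TermPred.Query L) (hQ : TermPred.NonTerminating P c Q) :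
    ∃ R : ℕ, 2 ≤ R ∧ ∀ U : TermPred.MguRule L, TermPred.NonFloundering U P Q →
      ∀ r ≥ R, ∀ a : TermPred.Answer,
        TermPred.TPoLP U P Q r a ↔ a = .predictedNonTerminating := by
  obtain ⟨U₀, t, ht, N, hN0, hN⟩ := hQ
  obtain ⟨n, hn⟩ := TermPred.lifts_modedRoot ht
  refine ⟨n + 2, by omega, fun U hU r hr a => ?_⟩
  obtain ⟨M, e, w, hM0, hw0, hM⟩ := TermPred.exists_lift hN (by rwa [hN0]) hU
  have hall : ∀ o, TermPred.Build U P r [] Q.modedRoot false o → o = .stopped := fun o ho =>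
    ho.eq_stopped (fun i => (hM i).1) (by rw [hM0]; exact TermPred.modedRoot_wf Q) (by omega)
      (TermPred.not_termSizeDecrease_of_weight (fun i => (hM i).2.1) (fun i => (hM i).2.2)
        (by omega)) (i := 0) rfl hM0.symm
  constructor
  · rintro (⟨s, h⟩ | ⟨s, h⟩ | h)
    · exact absurd (hall _ h) (by simp)
    · exact absurd (hall _ h) (by simp)
    · rfl
  · rintro rfl
    obtain ⟨o, ho⟩ := TermPred.exists_build_modedRoot hU (r := r) (by omega)
    exact .predictedNonTerminating (hall o ho ▸ ho)
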